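/- Let $\mathcal H$ be a separable complex Hilbert space (inner product linear in the second variable) and $H$ a self-adjoint operator on $\mathcal H$ with spectral measure $E_H$. For $\psi\in\mathcal H$ put $\mu_\psi(B)=\|E_H(B)\psi\|^2$ for Borel sets $B\subset\mathbb R$. A non-zero vector $\phi\in\bigcap_{n\ge1}D(H^n)$ is cyclic for $H$ if the linear hull of $\{H^n\phi : n\ge 0\}$ is dense in $\mathcal H$. Call a cyclic vector $\phi$ *regular* if $\mu_\phi$ has a density $\rho_\phi\ge0$ with respect to Lebesgue measure which is differentiable on $\mathbb R$ and satisfies $$\lim_{\lambda\to\pm\infty}\rho_\phi(\lambda)=0,\qquad \int_{\{\rho_\phi>0\}}\frac{\rho_\phi'(\lambda)^2}{\rho_\phi(\lambda)}\,d\lambda<\infty .$$ Suppose that $H\in S_0(\mathcal H)$, i.e. that $H$ is absolutely continuous ($\mu_\psi$ is absolutely continuous with respect to Lebesgue measure for every $\psi\in\mathcal H$) and has a regular cyclic vector. Then $H$ has a strong time operator, i.e. there is a densely defined symmetric operator $T$ on $\mathcal H$ such that, for all $t\in\mathbb R$, $e^{-itH}D(T)\subset D(T)$ and $Te^{-itH}\psi=e^{-itH}(T+t)\psi$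 for all $\psi\in D(T)$. More precisely, let $\phi$ be any regular cyclic vector of $H$, and let $W_\phi=\rho_\phi'/\rho_\phi$ where $\rho_\phi>0$ and $W_\phi=0$ where $\rho_\phi=0$. Then $$Y=i\frac{d}{d\lambda}+\frac i2W_\phi,\qquad D(Y)=\text{linear hull of }\{e^{it\lambda} : t\in\mathbb R\},$$ is a well-defined operator in $L^2(\mathbb R,d\mu_\phi)$, and there is a unitary operator $V:\mathcal H\to L^2(\mathbb R,d\mu_\phi)$ such that $V\phi=1$, $VHV^{-1}$ is the operator of multiplication by $\lambda$ (with its maximal domain), and $V^{-1}YV$ is a strong time operator of $H$. -/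

import Mathlib

open MeasureTheory Filter Topology
open scoped ENNReal InnerProductSpace

namespace TimeOp

variable {ℋ : Type*} [NormedAddCommGroup ℋ] [InnerProductSpace ℂ ℋ] [CompleteSpace ℋ]

/-- A projection-valued measure on the Borel sets of `ℝ`: a strongly countably additive family of
orthogonal projections with `E ∅ = 0`, `E ℝ = 1` and `E (A ∩ B) = E A * E B`.
Only the values on Borel sets matter. -/
structure PVM (ℋ : Type*) [NormedAddCommGroup ℋ] [InnerProductSpace ℂ ℋ] [CompleteSpace ℋ] where
  proj : Set ℝ → (ℋ →L[ℂ] ℋ)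
  isProj : ∀ B, MeasurableSet B → IsStarProjection (proj B)
  empty : proj ∅ = 0
  univ : proj Set.univ = 1
  inter : ∀ A B, MeasurableSet A → MeasurableSet B → proj (A ∩ B) = proj A * proj B
  hasSum : ∀ B : ℕ → Set ℝ, (∀ n, MeasurableSet (B n)) → Pairwise (Function.onFun Disjoint B) →
    ∀ ψ, HasSum (fun n => proj (B n) ψ) (proj (⋃ n, B n) ψ)

theorem PVM.norm_sq (E : PVM ℋ) {B : Set ℝ} (hB : MeasurableSet B) (ψ : ℋ) :
    ‖E.proj B ψ‖ ^ 2 = (⟪ψ, E.proj B ψ⟫_ℂ).re := by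
  have h := E.isProj B hB
  have h1 : E.proj B (E.proj B ψ) = E.proj B ψ := by
    have := congrArg (fun A : ℋ →L[ℂ] ℋ => A ψ) h.isIdempotentElem.eq
    simpa using this
  have h2 : ⟪E.proj B ψ, E.proj B ψ⟫_ℂ = ⟪ψ, E.proj B ψ⟫_ℂ := by
    have h3 := ContinuousLinearMap.adjoint_inner_right (E.proj B) ψ (E.proj B ψ)
    rw [← ContinuousLinearMap.star_eq_adjoint, h.isSelfAdjoint.star_eq, h1] at h3
    exact h3.symm
  rw [← h2, inner_self_eq_norm_sq_to_K]
  norm_cast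

/-- The finite Borel measure `μ_ψ(B) = ‖E(B)ψ‖²`. -/
noncomputable def PVM.vecMeasure (E : PVM ℋ) (ψ : ℋ) : Measure ℝ :=
  Measure.ofMeasurable (fun B _ => ENNReal.ofReal (‖E.proj B ψ‖ ^ 2))
    (by simp [E.empty])
    (by
      intro B hB hd
      have hs : HasSum (fun n => ‖E.proj (B n) ψ‖ ^ 2) (‖E.proj (⋃ n, B n) ψ‖ ^ 2) := by
        have h := E.hasSum B hB hd ψ
        have h1 := Complex.hasSum_re ((innerSL ℂ ψ).hasSum h)
        rw [E.norm_sq (MeasurableSet.iUnion hB)]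
        simp_rw [fun n => E.norm_sq (hB n) ψ]
        simpa using h1
      rw [← hs.tsum_eq]
      exact ENNReal.ofReal_tsum_of_nonneg (fun n => sq_nonneg _) hs.summable)

/-- The point mass at `0` with full projection, used only as a default value. -/
noncomputable def PVM.diracZero (ℋ : Type*) [NormedAddCommGroup ℋ] [InnerProductSpace ℂ ℋ]
    [CompleteSpace ℋ] : PVM ℋ := by
  classical
  exact
  { proj := fun B => if (0 : ℝ) ∈ B then 1 else 0
    isProj := by
      intro B _
      split_ifs
      · exact ⟨IsIdempotentElem.one, IsSelfAdjoint.one _⟩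
      · exact ⟨IsIdempotentElem.zero, IsSelfAdjoint.zero _⟩
    empty := by simp
    univ := by simp
    inter := by
      intro A B _ _
      by_cases hA : (0 : ℝ) ∈ A <;> by_cases hB : (0 : ℝ) ∈ B <;> simp [hA, hB]
    hasSum := by
      intro B _ hd ψ
      by_cases h : (0 : ℝ) ∈ ⋃ n, B n
      · obtain ⟨n, hn⟩ := Set.mem_iUnion.1 h
        have h2 := hasSum_single (f := fun m =>
          (if (0 : ℝ) ∈ B m then (1 : ℋ →L[ℂ] ℋ) else 0) ψ) n (by
            intro m hm
            have : (0 : ℝ) ∉ B m := fun h' => Set.disjoint_left.1 (hd hm) h' hn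
            simp [this])
        simpa [hn, h] using h2
      · have h' : ∀ n, (0 : ℝ) ∉ B n := fun n hn => h (Set.mem_iUnion.2 ⟨n, hn⟩)
        rw [if_neg h]
        simp only [h', if_false]
        exact hasSum_zero }

/-- `H = ∫ λ dE(λ)`: the domain of `H` consists of the `ψ` with `∫ λ² dμ_ψ < ∞`, and
`⟨ψ, Hψ⟩ = ∫ λ dμ_ψ` there. -/
def IsSpectralMeasure (H : ℋ →ₗ.[ℂ] ℋ) (E : PVM ℋ) : Prop :=
  (∀ ψ : ℋ, ψ ∈ H.domain ↔ Integrable (fun x : ℝ => x ^ 2) (E.vecMeasure ψ)) ∧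
  ∀ ψ : H.domain, ⟪(ψ : ℋ), H ψ⟫_ℂ = ((∫ x, x ∂(E.vecMeasure (ψ : ℋ)) : ℝ) : ℂ)

open Classical in
/-- The spectral measure `E_H`. For a self-adjoint `H` the projection-valued measure with
`H = ∫ λ dE(λ)` exists and is unique on Borel sets; the default value concerns other `H` only. -/
noncomputable def spectralMeasure (H : ℋ →ₗ.[ℂ] ℋ) : PVM ℋ :=
  if h : ∃ E : PVM ℋ, IsSpectralMeasure H E then h.choose else PVM.diracZero ℋ

/-- `μ_ψ(B) = ‖E_H(B)ψ‖²`. -/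
noncomputable def specMeas (H : ℋ →ₗ.[ℂ] ℋ) (ψ : ℋ) : Measure ℝ :=
  (spectralMeasure H).vecMeasure ψ

/-- `A = f(H) = ∫ f dE_H` for a bounded Borel function `f`; by polarization at most one bounded
operator has this property. -/
def IsFunCalc (H : ℋ →ₗ.[ℂ] ℋ) (f : ℝ → ℂ) (A : ℋ →L[ℂ] ℋ) : Prop :=
  ∀ ψ : ℋ, ⟪ψ, A ψ⟫_ℂ = ∫ x, f x ∂(specMeas H ψ)

/-- A (densely defined) symmetric operator. -/
def IsSymmetricOp (T : ℋ →ₗ.[ℂ] ℋ) : Prop :=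
  Dense (T.domain : Set ℋ) ∧ T.IsFormalAdjoint T

/-- `(A, B)` is a weak Weyl representation: `A` is self-adjoint, `B` is symmetric,
`e^{-itA} D(B) ⊆ D(B)` and `B e^{-itA} ψ = e^{-itA} (B + t) ψ` for all `ψ ∈ D(B)`, `t ∈ ℝ`.
Here `U t` is the operator `e^{-itA}`. -/
def IsWeakWeyl (A B : ℋ →ₗ.[ℂ] ℋ) : Prop :=
  IsSelfAdjoint A ∧ IsSymmetricOp B ∧
  ∃ U : ℝ → (ℋ →L[ℂ] ℋ),
    (∀ t : ℝ, IsFunCalc A (fun x => Complex.exp (-(Complex.I * t * x))) (U t)) ∧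
    ∀ (t : ℝ) (ψ : B.domain), ∃ h : U t (ψ : ℋ) ∈ B.domain,
      B ⟨U t (ψ : ℋ), h⟩ = U t (B ψ + (t : ℂ) • (ψ : ℋ))

/-- `T` is a strong time operator of `H`. -/
def IsStrongTimeOperator (H T : ℋ →ₗ.[ℂ] ℋ) : Prop := IsWeakWeyl H T

/-- `φ` is a nonzero vector in the domains of all powers of `H` (`x n = Hⁿφ`) and the linear hull
of the vectors `Hⁿφ` is dense. -/
def IsCyclicVector (H : ℋ →ₗ.[ℂ] ℋ) (φ : ℋ) : Prop :=
  φ ≠ 0 ∧ ∃ x : ℕ → H.domain, (x 0 : ℋ) = φ ∧ (∀ n, (x (n + 1) : ℋ) = H (x n)) ∧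
    Dense (Submodule.span ℂ (Set.range fun n => (x n : ℋ)) : Set ℋ)

/-- Every `μ_ψ` is absolutely continuous with respect to Lebesgue measure. -/
def IsAbsCont (H : ℋ →ₗ.[ℂ] ℋ) : Prop := ∀ ψ : ℋ, specMeas H ψ ≪ volume

/-- `φ` is a cyclic vector for `H`, and `ρ` is a density of `μ_φ` that is differentiable on `ℝ`,
vanishes at `±∞` and has finite Fisher information. -/
structure IsRegularCyclic (H : ℋ →ₗ.[ℂ] ℋ) (φ : ℋ) (ρ : ℝ → ℝ) : Prop where
  cyclic : IsCyclicVector H φ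
  nonneg : ∀ x, 0 ≤ ρ x
  density : specMeas H φ = volume.withDensity fun x => ENNReal.ofReal (ρ x)
  differentiable : Differentiable ℝ ρ
  tendsto_atTop : Tendsto ρ atTop (𝓝 0)
  tendsto_atBot : Tendsto ρ atBot (𝓝 0)
  fisher : IntegrableOn (fun x => deriv ρ x ^ 2 / ρ x) {x | 0 < ρ x} volume

/-- The class `S₀(ℋ)` of self-adjoint operators. -/
structure InS0 (H : ℋ →ₗ.[ℂ] ℋ) : Prop where
  selfAdjoint : IsSelfAdjoint H
  absCont : IsAbsCont H
  exists_cyclic : ∃ (φ : ℋ) (ρ : ℝ → ℝ), IsRegularCyclic H φ ρ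

open Classical in
/-- `W = ρ'/ρ` where `ρ > 0`, and `0` where `ρ = 0`. -/
noncomputable def logSlope (ρ : ℝ → ℝ) (x : ℝ) : ℝ :=
  if 0 < ρ x then deriv ρ x / ρ x else 0

/-- The linear hull of the functions `λ ↦ e^{itλ}`, `t ∈ ℝ`. -/
noncomputable def expSpan : Submodule ℂ (ℝ → ℂ) :=
  Submodule.span ℂ (Set.range fun t : ℝ => fun x : ℝ => Complex.exp (Complex.I * t * x))

theorem differentiable_of_mem_expSpan {F : ℝ → ℂ} (hF : F ∈ expSpan) : Differentiable ℝ F := by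
  unfold expSpan at hF
  induction hF using Submodule.span_induction with
  | mem F h =>
    obtain ⟨t, rfl⟩ := h
    intro x
    have h1 : HasDerivAt (fun y : ℝ => (y : ℂ)) 1 x := Complex.ofRealCLM.hasDerivAt
    exact ((h1.const_mul (Complex.I * t)).cexp).differentiableAt
  | zero => exact differentiable_const 0
  | add F G _ _ hF hG => exact hF.add hG
  | smul c F _ hF => exact hF.const_smul c

/-- The graph of `i d/dλ + (i/2) W` on the linear hull of the `e^{itλ}`, in `L²(μ)`: the pairs
`(F, i F' + (i/2) W F)` of classes in `L²(μ)`, with `F` in that linear hull. -/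
noncomputable def timeGraph (μ : Measure ℝ) (ρ : ℝ → ℝ) :
    Submodule ℂ (Lp ℂ 2 μ × Lp ℂ 2 μ) where
  carrier := {p | ∃ F ∈ expSpan, (p.1 : ℝ → ℂ) =ᵐ[μ] F ∧
    (p.2 : ℝ → ℂ) =ᵐ[μ] fun x =>
      Complex.I * deriv F x + Complex.I / 2 * (logSlope ρ x : ℂ) * F x}
  zero_mem' := by
    refine ⟨0, Submodule.zero_mem _, Lp.coeFn_zero _ _ _, ?_⟩
    filter_upwards [Lp.coeFn_zero ℂ 2 μ] with x hx
    simpa using hx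
  add_mem' := by
    rintro p q ⟨F, hF, hp1, hp2⟩ ⟨G, hG, hq1, hq2⟩
    refine ⟨F + G, Submodule.add_mem _ hF hG, ?_, ?_⟩
    · exact (Lp.coeFn_add p.1 q.1).trans (hp1.add hq1)
    · filter_upwards [Lp.coeFn_add p.2 q.2, hp2, hq2] with x h hp hq
      have hd : deriv (F + G) x = deriv F x + deriv G x :=
        deriv_add (differentiable_of_mem_expSpan hF x) (differentiable_of_mem_expSpan hG x)
      simp only [Prod.snd_add, h, Pi.add_apply, hp, hq, hd]
      ring
  smul_mem' := by
    rintro c p ⟨F, hF, hp1, hp2⟩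
    refine ⟨c • F, Submodule.smul_mem _ c hF, ?_, ?_⟩
    · exact (Lp.coeFn_smul c p.1).trans (hp1.const_smul c)
    · filter_upwards [Lp.coeFn_smul c p.2, hp2] with x h hp
      have hd : deriv (c • F) x = c • deriv F x :=
        deriv_const_smul c (differentiable_of_mem_expSpan hF x)
      simp only [Prod.smul_snd, h, Pi.smul_apply, hp, hd, smul_eq_mul]
      ring

/-- The operator `Y = i d/dλ + (i/2) W` in `L²(μ)` with domain the linear hull of the `e^{itλ}`. -/
noncomputable def timeOp (μ : Measure ℝ) (ρ : ℝ → ℝ) : Lp ℂ 2 μ →ₗ.[ℂ] Lp ℂ 2 μ :=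
  (timeGraph μ ρ).toLinearPMap

/-- The maximal multiplication operator `M_X` by `X(λ) = λ` in `L²(μ)`. -/
noncomputable def mulX (μ : Measure ℝ) : Lp ℂ 2 μ →ₗ.[ℂ] Lp ℂ 2 μ where
  domain :=
    { carrier := {f | MemLp (fun x : ℝ => (x : ℂ) * f x) 2 μ}
      zero_mem' := by
        refine (MemLp.zero' (ε := ℂ) (p := 2) (μ := μ)).ae_eq ?_
        filter_upwards [Lp.coeFn_zero ℂ 2 μ] with x hx
        rw [hx]
        simp
      add_mem' := by
        intro f g hf hg
        refine (MemLp.add hf hg).ae_eq ?_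
        filter_upwards [Lp.coeFn_add f g] with x hx
        have hx' : (x : ℂ) * (f x + g x) = x * f x + x * g x := mul_add _ _ _
        rw [hx]
        exact hx'.symm
      smul_mem' := by
        intro c f hf
        refine (MemLp.const_smul hf c).ae_eq ?_
        filter_upwards [Lp.coeFn_smul c f] with x hx
        simp [hx, mul_left_comm] }
  toFun :=
    { toFun := fun f => MemLp.toLp _ f.2
      map_add' := by
        intro f g
        rw [← MemLp.toLp_add]
        refine MemLp.toLp_congr _ _ ?_
        filter_upwards [Lp.coeFn_add (f : Lp ℂ 2 μ) g] with x hx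
        change (x : ℂ) * ((f : Lp ℂ 2 μ) + (g : Lp ℂ 2 μ) : Lp ℂ 2 μ) x = _
        rw [hx]
        exact mul_add _ _ _
      map_smul' := by
        intro c f
        rw [RingHom.id_apply, ← MemLp.toLp_const_smul]
        refine MemLp.toLp_congr _ _ ?_
        filter_upwards [Lp.coeFn_smul c (f : Lp ℂ 2 μ)] with x hx
        simp [hx, mul_left_comm] }

/-- The operator `V⁻¹ S V`, with domain `V⁻¹ D(S)`, for a unitary `V`. -/
def pullback {𝒦 : Type*} [NormedAddCommGroup 𝒦] [InnerProductSpace ℂ 𝒦]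
    (V : ℋ ≃ₗᵢ[ℂ] 𝒦) (S : 𝒦 →ₗ.[ℂ] 𝒦) : ℋ →ₗ.[ℂ] ℋ where
  domain := S.domain.comap (V.toLinearEquiv : ℋ →ₗ[ℂ] 𝒦)
  toFun :=
    { toFun := fun ψ => V.symm (S ⟨V ψ, ψ.2⟩)
      map_add' := by
        intro a b
        rw [← map_add V.symm, ← LinearPMap.map_add]
        congr 2
        ext
        simp
      map_smul' := by
        intro c a
        rw [RingHom.id_apply, ← map_smul V.symm, ← LinearPMap.map_smul]
        congr 2
        ext
        simp }

end TimeOp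

/-!
In a spectral representation `H` is multiplication by `λ`, and a time operator is then
`i d/dλ` corrected by half the logarithmic derivative of the density.

The spectral measure comes from the resolvent `R = (H - i)⁻¹`, a normal operator. Riesz–Markov
represents `f ↦ ⟪φ, f(R) φ⟫` by a measure `ν` on the spectrum of `R`, so `f ↦ f(R) φ` extends to an
isometry of `L²(ν)` into `ℋ`. It is onto because `φ` is cyclic for `H`, and carries multiplication
by the real function `i + 1/r` to `H`. Once `E` is available, `1_B ↦ E(B) φ` extends in the same
way to a unitary of `L²(μ_φ)` onto `ℋ`.

Let `dμ_φ = ρ dλ` and `W = ρ'/ρ`. Integration by parts makes `-(d/dλ + W)` the formal adjoint of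
`d/dλ` in `L²(μ_φ)`, so `Y = i (d/dλ + W/2)` is symmetric. Finite Fisher information says
`W ∈ L²(μ_φ)`, so `Y` is defined on trigonometric polynomials. It respects a.e. equality, since one
that vanishes `μ_φ`-a.e. vanishes, with its derivative, on the open set `{ρ > 0}`; its domain is
dense by uniqueness of Fourier transforms. The Weyl relation is the product rule applied to
`e^{-itλ} F`.
-/

namespace TimeOp

section Hilbert

variable {X Y : Type*} [NormedAddCommGroup X] [NormedAddCommGroup Y]

theorem exists_linearIsometry_of_inner_eq {𝕜 ι : Type*} [RCLike 𝕜] [InnerProductSpace 𝕜 X]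
    [InnerProductSpace 𝕜 Y] [CompleteSpace Y] {v : ι → X} {w : ι → Y}
    (hv : Dense (Submodule.span 𝕜 (Set.range v) : Set X))
    (h : ∀ i j, ⟪v i, v j⟫_𝕜 = ⟪w i, w j⟫_𝕜) : ∃ J : X →ₗᵢ[𝕜] Y, ∀ i, J (v i) = w i := by
  let A := Finsupp.linearCombination 𝕜 v
  let B := Finsupp.linearCombination 𝕜 w
  have hA : DenseRange A := by
    rw [DenseRange, ← LinearMap.coe_range, Finsupp.range_linearCombination]
    exact hv
  have hnorm : ∀ c, ‖B c‖ = ‖A c‖ := by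
    intro c
    have : ⟪B c, B c⟫_𝕜 = ⟪A c, A c⟫_𝕜 := by
      simp only [A, B, Finsupp.linearCombination_apply, Finsupp.sum, inner_sum, sum_inner,
        inner_smul_left, inner_smul_right, h]
    rw [norm_eq_sqrt_re_inner (𝕜 := 𝕜), norm_eq_sqrt_re_inner (𝕜 := 𝕜), this]
  have hext : ∀ c, B.extendOfNorm A (A c) = B c :=
    LinearMap.extendOfNorm_eq hA ⟨1, fun c => by rw [hnorm, one_mul]⟩
  refine ⟨⟨(B.extendOfNorm A).toLinearMap, fun x => ?_⟩, fun i => ?_⟩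
  · refine hA.induction_on (p := fun x => ‖B.extendOfNorm A x‖ = ‖x‖) x ?_ fun c => ?_
    · exact isClosed_eq (B.extendOfNorm A).continuous.norm continuous_norm
    · rw [hext, hnorm]
  · simpa [A, B] using hext (Finsupp.single i 1)

theorem apply_eq_zero_of_forall_inner_self [InnerProductSpace ℂ X] {T : X →ₗ.[ℂ] X}
    (hT : Dense (T.domain : Set X)) (h : ∀ x : T.domain, ⟪(x : X), T x⟫_ℂ = 0) (y : T.domain) :
    T y = 0 := by
  refine hT.eq_zero_of_inner_right ℂ fun x hx => ?_
  lift x to T.domain using hx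
  have h_one := h (x + y)
  have h_I := h (x + Complex.I • y)
  simp only [LinearPMap.map_add, LinearPMap.map_smul, Submodule.coe_add, Submodule.coe_smul,
    inner_add_left, inner_add_right, inner_smul_left, inner_smul_right, h,
    Complex.conj_I] at h_one h_I
  have h_two : (2 : ℂ) * ⟪(x : X), T y⟫_ℂ = 0 := by
    linear_combination h_one - Complex.I * h_I +
      (⟪(x : X), T y⟫_ℂ - ⟪(y : X), T x⟫_ℂ) * Complex.I_sq
  simpa using h_two

theorem hasSum_of_orthogonal {𝕜 ι : Type*} [RCLike 𝕜] [InnerProductSpace 𝕜 X] {x : ι → X} {y : X}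
    (hx : Pairwise fun i j => ⟪x i, x j⟫_𝕜 = 0) (hxy : ∀ i, ⟪x i, y⟫_𝕜 = ⟪x i, x i⟫_𝕜)
    (hsum : HasSum (fun i => ⟪x i, x i⟫_𝕜) ⟪y, y⟫_𝕜) : HasSum x y := by
  have hinner : ∀ s : Finset ι, ⟪∑ i ∈ s, x i, y - ∑ i ∈ s, x i⟫_𝕜 = 0 := fun s => by
    rw [sum_inner]
    refine Finset.sum_eq_zero fun i hi => ?_
    rw [inner_sub_right, inner_sum, hxy, sub_eq_zero, Finset.sum_eq_single_of_mem i hi]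
    exact fun j _ hji => hx hji.symm
  have hnorm : ∀ s : Finset ι,
      ⟪y, y⟫_𝕜 - ∑ i ∈ s, ⟪x i, x i⟫_𝕜 = ((‖(∑ i ∈ s, x i) - y‖ ^ 2 : ℝ) : 𝕜) := fun s => by
    have hself : ⟪y - ∑ i ∈ s, x i, y⟫_𝕜 = ⟪y, y⟫_𝕜 - ∑ i ∈ s, ⟪x i, x i⟫_𝕜 := by
      simp only [inner_sub_left, sum_inner, hxy]
    rw [← hself, norm_sub_rev, RCLike.ofReal_pow, ← inner_self_eq_norm_sq_to_K, inner_sub_right,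
      ← inner_conj_symm _ (∑ i ∈ s, x i), hinner, map_zero, sub_zero]
  have hlim : Tendsto (fun s : Finset ι => ‖(∑ i ∈ s, x i) - y‖ ^ 2) atTop (𝓝 0) := by
    have hsum' : Tendsto (fun s : Finset ι => ∑ i ∈ s, ⟪x i, x i⟫_𝕜) atTop (𝓝 ⟪y, y⟫_𝕜) := hsum
    have h := RCLike.continuous_re.tendsto _ |>.comp (hsum'.const_sub ⟪y, y⟫_𝕜)
    simpa only [Function.comp_def, hnorm, RCLike.ofReal_re, sub_self, map_zero] using h
  have hroot : Tendsto (fun s : Finset ι => ‖(∑ i ∈ s, x i) - y‖) atTop (𝓝 0) := by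
    simpa only [Real.sqrt_sq (norm_nonneg _), Real.sqrt_zero] using hlim.sqrt
  exact tendsto_iff_norm_sub_tendsto_zero.2 hroot

theorem mem_of_apply_mem [InnerProductSpace ℂ X] [CompleteSpace X] {K : Submodule ℂ X}
    [K.HasOrthogonalProjection] {R : X →L[ℂ] X}
    (hinj : Function.Injective R) (hK : ∀ χ ∈ K, R χ ∈ K) (hK' : ∀ χ ∈ K, star R χ ∈ K) {χ : X}
    (hχ : R χ ∈ K) : χ ∈ K := by
  obtain ⟨y, hy, u, hu, rfl⟩ := K.exists_add_mem_mem_orthogonal χ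
  have hRu : R u ∈ K := by simpa using K.sub_mem hχ (hK y hy)
  have hRu' : R u ∈ Kᗮ := fun k hk => by
    rw [← ContinuousLinearMap.adjoint_inner_left, ← ContinuousLinearMap.star_eq_adjoint]
    exact hu _ (hK' k hk)
  have hzero : u = 0 := (injective_iff_map_eq_zero R).1 hinj u
    (inner_self_eq_zero.1 (hRu' _ hRu))
  rwa [hzero, add_zero]

end Hilbert

section Multiplication

variable {α 𝕜 : Type*} [MeasurableSpace α] {μ : Measure α} [RCLike 𝕜] {p : ℝ≥0∞} [Fact (1 ≤ p)]

/-- The bounded operator of multiplication by an essentially bounded function in `L^p(μ)`. -/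
noncomputable def mulOp {m : α → 𝕜} (hm : MemLp m ∞ μ) : Lp 𝕜 p μ →L[𝕜] Lp 𝕜 p μ :=
  (ContinuousLinearMap.mul 𝕜 𝕜).holderL μ ∞ p p (hm.toLp m)

theorem coeFn_mulOp {m : α → 𝕜} (hm : MemLp m ∞ μ) (f : Lp 𝕜 p μ) :
    mulOp hm f =ᵐ[μ] fun x => m x * f x := by
  filter_upwards [(ContinuousLinearMap.mul 𝕜 𝕜).coeFn_holder (r := p) (hm.toLp m) f,
    hm.coeFn_toLp] with x hx hmx
  rw [← hmx]
  exact hx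

theorem mulOp_mul_mulOp {m n k : α → 𝕜} (hm : MemLp m ∞ μ) (hn : MemLp n ∞ μ)
    (hk : MemLp k ∞ μ) (h : ∀ᵐ x ∂μ, m x * n x = k x) :
    (mulOp hm * mulOp hn : Lp 𝕜 p μ →L[𝕜] Lp 𝕜 p μ) = mulOp hk := by
  refine ContinuousLinearMap.ext fun f => Lp.ext ?_
  filter_upwards [coeFn_mulOp hm (mulOp hn f), coeFn_mulOp hn f, coeFn_mulOp hk f, h]
    with x h1 h2 h3 hx
  rw [mul_apply_eq_comp, h1, h2, h3, ← hx, mul_assoc]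

theorem star_mulOp {m n : α → 𝕜} (hm : MemLp m ∞ μ) (hn : MemLp n ∞ μ)
    (h : ∀ᵐ x ∂μ, starRingEnd 𝕜 (m x) = n x) :
    star (mulOp hm : Lp 𝕜 2 μ →L[𝕜] Lp 𝕜 2 μ) = mulOp hn := by
  refine Eq.symm ((ContinuousLinearMap.eq_adjoint_iff _ _).2 fun f g => ?_)
  rw [L2.inner_def, L2.inner_def]
  refine integral_congr_ae ?_
  filter_upwards [coeFn_mulOp hn f, coeFn_mulOp hm g, h] with x h1 h2 hx
  rw [h1, h2, ← hx, ← smul_eq_mul, ← smul_eq_mul, inner_smul_left, inner_smul_right,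
    RCLike.conj_conj]

theorem inner_mulOp {m : α → 𝕜} (hm : MemLp m ∞ μ) (f g : Lp 𝕜 2 μ) :
    ⟪f, mulOp hm g⟫_𝕜 = ∫ x, m x * ⟪f x, g x⟫_𝕜 ∂μ := by
  rw [L2.inner_def]
  refine integral_congr_ae ?_
  filter_upwards [coeFn_mulOp hm g] with x hx
  rw [hx, ← smul_eq_mul (m x) (g x), inner_smul_right]

theorem memLp_top_indicator_one {B : Set α} (hB : MeasurableSet B) :
    MemLp (B.indicator fun _ => (1 : 𝕜)) ∞ μ :=
  (memLp_top_const 1).indicator hB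

/-- Multiplication by the indicator function of a measurable set in `L^p(μ)`. -/
noncomputable def indicatorOp {B : Set α} (hB : MeasurableSet B) : Lp 𝕜 p μ →L[𝕜] Lp 𝕜 p μ :=
  mulOp (memLp_top_indicator_one hB)

theorem coeFn_indicatorOp {B : Set α} (hB : MeasurableSet B) (f : Lp 𝕜 p μ) :
    indicatorOp hB f =ᵐ[μ] B.indicator f := by
  filter_upwards [coeFn_mulOp (memLp_top_indicator_one hB) f] with x hx
  rw [indicatorOp, hx]
  by_cases h : x ∈ B <;> simp [h]

theorem indicatorOp_mul_indicatorOp {A B : Set α} (hA : MeasurableSet A) (hB : MeasurableSet B) :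
    (indicatorOp hA * indicatorOp hB : Lp 𝕜 p μ →L[𝕜] Lp 𝕜 p μ) = indicatorOp (hA.inter hB) :=
  mulOp_mul_mulOp _ _ _ <| .of_forall fun x => by
    by_cases hxA : x ∈ A <;> by_cases hxB : x ∈ B <;> simp [hxA, hxB]

theorem isStarProjection_indicatorOp {B : Set α} (hB : MeasurableSet B) :
    IsStarProjection (indicatorOp hB : Lp 𝕜 2 μ →L[𝕜] Lp 𝕜 2 μ) where
  isIdempotentElem := by
    simp only [IsIdempotentElem, indicatorOp_mul_indicatorOp, Set.inter_self]
  isSelfAdjoint := star_mulOp _ _ <| .of_forall fun x => by by_cases h : x ∈ B <;> simp [h]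

theorem enorm_sq_eq_lintegral {F : Type*} [NormedAddCommGroup F] (f : Lp F 2 μ) :
    ‖f‖ₑ ^ 2 = ∫⁻ x, ‖f x‖ₑ ^ 2 ∂μ := by
  rw [Lp.enorm_def, eLpNorm_eq_lintegral_rpow_enorm_toReal (by simp) (by simp),
    ← ENNReal.rpow_natCast, ← ENNReal.rpow_mul]
  simp

theorem enorm_sq_indicatorOp {B : Set α} (hB : MeasurableSet B) (f : Lp 𝕜 2 μ) :
    ‖indicatorOp hB f‖ₑ ^ 2 = ∫⁻ x in B, ‖f x‖ₑ ^ 2 ∂μ := by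
  rw [enorm_sq_eq_lintegral, ← lintegral_indicator hB]
  refine lintegral_congr_ae ?_
  filter_upwards [coeFn_indicatorOp hB f] with x hx
  rw [hx]
  by_cases h : x ∈ B <;> simp [h]

theorem indicatorOp_indicatorConstLp [IsFiniteMeasure μ] {A B : Set α} (hA : MeasurableSet A)
    (hB : MeasurableSet B) (c : 𝕜) :
    indicatorOp hB (indicatorConstLp p hA (measure_ne_top μ A) c) =
      indicatorConstLp p (hB.inter hA) (measure_ne_top μ _) c := by
  refine Lp.ext ?_
  filter_upwards [coeFn_indicatorOp hB (indicatorConstLp p hA (measure_ne_top μ A) c),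
    indicatorConstLp_coeFn (p := p) (hs := hA) (hμs := measure_ne_top μ _) (c := c),
    indicatorConstLp_coeFn (p := p) (hs := hB.inter hA) (hμs := measure_ne_top μ _) (c := c)]
    with x h1 h2 h3
  rw [h1, h3, ← Set.indicator_indicator]
  by_cases h : x ∈ B <;> simp [h, h2]

theorem dense_span_indicatorConstLp [IsFiniteMeasure μ] (hp : p ≠ ∞) :
    Dense (Submodule.span 𝕜 (Set.range fun B : {B : Set α // MeasurableSet B} =>
      indicatorConstLp p B.2 (measure_ne_top μ B) (1 : 𝕜)) : Set (Lp 𝕜 p μ)) := by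
  set S := Submodule.span 𝕜 (Set.range fun B : {B : Set α // MeasurableSet B} =>
    indicatorConstLp p B.2 (measure_ne_top μ B) (1 : 𝕜))
  refine fun f => Lp.induction hp (fun f => f ∈ closure (S : Set (Lp 𝕜 p μ))) ?_ ?_ ?_ f
  · intro c B hB hμB
    have hc : indicatorConstLp p hB hμB.ne c = c • indicatorConstLp p hB hμB.ne (1 : 𝕜) := by
      rw [indicatorConstLp, indicatorConstLp, ← MemLp.toLp_const_smul]
      congr 1
      ext x
      by_cases h : x ∈ B <;> simp [h]
    rw [Lp.simpleFunc.coe_indicatorConst, hc]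
    exact subset_closure (S.smul_mem c (Submodule.subset_span ⟨⟨B, hB⟩, rfl⟩))
  · intro f g hf hg _ hfS hgS
    rw [← Submodule.topologicalClosure_coe] at hfS hgS ⊢
    exact Submodule.add_mem _ hfS hgS
  · exact isClosed_closure

theorem inner_indicatorOp_indicatorOp {A B : Set α} (hA : MeasurableSet A)
    (hB : MeasurableSet B) (f g : Lp 𝕜 2 μ) :
    ⟪indicatorOp hA f, indicatorOp hB g⟫_𝕜 = ∫ x in A ∩ B, ⟪f x, g x⟫_𝕜 ∂μ := by
  rw [L2.inner_def, ← integral_indicator (hA.inter hB)]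
  refine integral_congr_ae ?_
  filter_upwards [coeFn_indicatorOp hA f, coeFn_indicatorOp hB g] with x hf hg
  rw [hf, hg]
  by_cases hxA : x ∈ A <;> by_cases hxB : x ∈ B <;> simp [hxA, hxB]

theorem indicatorOp_empty :
    (indicatorOp .empty : Lp 𝕜 p μ →L[𝕜] Lp 𝕜 p μ) = 0 := by
  refine ContinuousLinearMap.ext fun f => Lp.ext ?_
  filter_upwards [coeFn_indicatorOp .empty f, Lp.coeFn_zero 𝕜 p μ] with x hf hzero
  rw [hf, Set.indicator_empty, zero_apply, hzero, Pi.zero_apply]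

theorem indicatorOp_univ :
    (indicatorOp .univ : Lp 𝕜 p μ →L[𝕜] Lp 𝕜 p μ) = 1 := by
  refine ContinuousLinearMap.ext fun f => Lp.ext ?_
  filter_upwards [coeFn_indicatorOp .univ f] with x hf
  rw [hf, Set.indicator_univ, one_apply_eq_self]

theorem hasSum_indicatorOp {ι : Type*} [Countable ι] {B : ι → Set α}
    (hB : ∀ i, MeasurableSet (B i)) (hdisj : Pairwise (Function.onFun Disjoint B))
    (f : Lp 𝕜 2 μ) :
    HasSum (fun i => indicatorOp (hB i) f) (indicatorOp (MeasurableSet.iUnion hB) f) := by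
  refine hasSum_of_orthogonal (𝕜 := 𝕜) (fun i j hij => ?_) (fun i => ?_) ?_ <;>
    simp only [inner_indicatorOp_indicatorOp, Set.inter_self]
  · rw [(hdisj hij).inter_eq, setIntegral_empty]
  · rw [Set.inter_eq_left.2 (Set.subset_iUnion B i)]
  · exact hasSum_integral_iUnion hB hdisj (L2.integrable_inner f f).integrableOn

theorem ae_ne_zero_of_mulOp_injective [IsFiniteMeasure μ] {m : α → 𝕜}
    (hmeas : Measurable m) (hm : MemLp m ∞ μ)
    (hinj : Function.Injective (mulOp hm : Lp 𝕜 p μ →L[𝕜] Lp 𝕜 p μ)) : ∀ᵐ x ∂μ, m x ≠ 0 := by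
  have hB : MeasurableSet {x | m x = 0} := hmeas (measurableSet_singleton 0)
  set f : Lp 𝕜 p μ := indicatorConstLp p hB (measure_ne_top μ _) 1
  have hmf : mulOp hm f = 0 := by
    refine (Lp.eq_zero_iff_ae_eq_zero).2 ?_
    filter_upwards [coeFn_mulOp hm f, indicatorConstLp_coeFn (μ := μ) (p := p) (hs := hB)
      (hμs := measure_ne_top μ _) (c := (1 : 𝕜))] with x hx hf
    rw [hx, hf]
    by_cases h : m x = 0 <;> simp [h]
  have hf : f = 0 := (injective_iff_map_eq_zero _).1 hinj f hmf
  filter_upwards [(Lp.eq_zero_iff_ae_eq_zero).1 hf, indicatorConstLp_coeFn (μ := μ) (p := p)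
    (hs := hB) (hμs := measure_ne_top μ _) (c := (1 : 𝕜))] with x hzero hx h
  have hmem : x ∈ {x | m x = 0} := h
  rw [hzero, Set.indicator_of_mem hmem] at hx
  exact zero_ne_one hx

end Multiplication

section PVM

variable {ℋ : Type*} [NormedAddCommGroup ℋ] [InnerProductSpace ℂ ℋ] [CompleteSpace ℋ]

namespace PVM

variable (E : PVM ℋ)

theorem vecMeasure_apply {B : Set ℝ} (hB : MeasurableSet B) (ψ : ℋ) :
    E.vecMeasure ψ B = ‖E.proj B ψ‖ₑ ^ 2 := by
  rw [vecMeasure, Measure.ofMeasurable_apply B hB, ENNReal.ofReal_pow (norm_nonneg _),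
    ofReal_norm]

instance isFiniteMeasure_vecMeasure (ψ : ℋ) : IsFiniteMeasure (E.vecMeasure ψ) where
  measure_univ_lt_top := by
    rw [E.vecMeasure_apply MeasurableSet.univ]
    exact ENNReal.pow_lt_top enorm_lt_top

theorem inner_proj_left {B : Set ℝ} (hB : MeasurableSet B) (ψ η : ℋ) :
    ⟪E.proj B ψ, η⟫_ℂ = ⟪ψ, E.proj B η⟫_ℂ := by
  rw [← ContinuousLinearMap.adjoint_inner_right, ← ContinuousLinearMap.star_eq_adjoint,
    (E.isProj B hB).isSelfAdjoint.star_eq]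

theorem proj_proj {A B : Set ℝ} (hA : MeasurableSet A) (hB : MeasurableSet B) (ψ : ℋ) :
    E.proj A (E.proj B ψ) = E.proj (A ∩ B) ψ := by
  rw [E.inter A B hA hB, mul_apply_eq_comp]

theorem inner_proj_self {B : Set ℝ} (hB : MeasurableSet B) (ψ : ℋ) :
    ⟪ψ, E.proj B ψ⟫_ℂ = ((E.vecMeasure ψ).real B : ℂ) := by
  rw [← B.inter_self, ← E.proj_proj hB hB, ← E.inner_proj_left hB, inner_self_eq_norm_sq_to_K,
    B.inter_self, measureReal_def, E.vecMeasure_apply hB, ENNReal.toReal_pow, toReal_enorm]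
  norm_cast

end PVM

variable {α : Type*} [MeasurableSpace α] {μ : Measure α} {h : α → ℝ}

/-- `J` intertwines multiplication by `1_B ∘ h` in `L²(μ)` with the projection `E(B)`, for every
Borel set `B`. -/
def Intertwines (hh : Measurable h) (E : PVM ℋ) (J : Lp ℂ 2 μ →ₗᵢ[ℂ] ℋ) : Prop :=
  ∀ (B : Set ℝ) (hB : MeasurableSet B) (f : Lp ℂ 2 μ),
    E.proj B (J f) = J (indicatorOp (hh hB) f)

theorem PVM.exists_intertwines (E : PVM ℋ) (φ : ℋ) :
    ∃ J : Lp ℂ 2 (E.vecMeasure φ) →ₗᵢ[ℂ] ℋ,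
      J (Lp.const 2 _ 1) = φ ∧ Intertwines measurable_id E J := by
  set μ := E.vecMeasure φ
  obtain ⟨J, hJ⟩ := exists_linearIsometry_of_inner_eq (w := fun B => E.proj B.1 φ)
    (dense_span_indicatorConstLp (μ := μ) (𝕜 := ℂ) (p := 2) (by simp)) (by
      rintro ⟨A, hA⟩ ⟨B, hB⟩
      dsimp only
      rw [L2.inner_indicatorConstLp_one_indicatorConstLp_one, E.inner_proj_left hA,
        E.proj_proj hA hB, E.inner_proj_self (hA.inter hB)]
      rfl)
  replace hJ : ∀ (B : Set ℝ) (hB : MeasurableSet B),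
      J (indicatorConstLp 2 hB (measure_ne_top μ B) 1) = E.proj B φ := fun B hB => hJ ⟨B, hB⟩
  refine ⟨J, ?_, fun B hB f => ?_⟩
  · rw [← indicatorConstLp_univ, hJ, E.univ, one_apply_eq_self]
  · have hEq : (E.proj B).comp J.toContinuousLinearMap =
        J.toContinuousLinearMap.comp (indicatorOp (measurable_id hB)) := by
      refine ContinuousLinearMap.ext_on (dense_span_indicatorConstLp (p := 2) (by simp)) ?_
      rintro _ ⟨⟨A, hA⟩, rfl⟩
      simp only [ContinuousLinearMap.comp_apply, LinearIsometry.coe_toContinuousLinearMap,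
        Set.preimage_id, indicatorOp_indicatorConstLp, hJ, E.proj_proj hB hA]
    exact congr($hEq f)

end PVM

section MulRep

variable {ℋ : Type*} [NormedAddCommGroup ℋ] [InnerProductSpace ℂ ℋ] [CompleteSpace ℋ]
  {α : Type*} [MeasurableSpace α] {μ : Measure α} {h : α → ℝ} {hh : Measurable h}
  {E : PVM ℋ} {H : ℋ →ₗ.[ℂ] ℋ}

namespace Intertwines

variable {J : Lp ℂ 2 μ →ₗᵢ[ℂ] ℋ}

theorem vecMeasure_eq (hJ : Intertwines hh E J) (f : Lp ℂ 2 μ) :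
    E.vecMeasure (J f) = (μ.withDensity fun x => ((‖f x‖₊ ^ 2 : NNReal) : ℝ≥0∞)).map h := by
  ext B hB
  rw [E.vecMeasure_apply hB, hJ B hB, J.enorm_map, enorm_sq_indicatorOp, Measure.map_apply hh hB,
    withDensity_apply _ (hh hB)]
  rfl

theorem integral_vecMeasure {F : Type*} [NormedAddCommGroup F] [NormedSpace ℝ F]
    (hJ : Intertwines hh E J) {g : ℝ → F} (hg : StronglyMeasurable g) (f : Lp ℂ 2 μ) :
    ∫ x, g x ∂(E.vecMeasure (J f)) = ∫ x, ‖f x‖ ^ 2 • g (h x) ∂μ := by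
  rw [hJ.vecMeasure_eq, integral_map hh.aemeasurable hg.aestronglyMeasurable,
    integral_withDensity_eq_integral_smul₀
      ((Lp.aestronglyMeasurable f).aemeasurable.nnnorm.pow_const 2)]
  rfl

theorem integrable_vecMeasure_iff (hJ : Intertwines hh E J) {g : ℝ → ℝ} (hg : StronglyMeasurable g)
    (f : Lp ℂ 2 μ) :
    Integrable g (E.vecMeasure (J f)) ↔ Integrable (fun x => ‖f x‖ ^ 2 * g (h x)) μ := by
  rw [hJ.vecMeasure_eq, integrable_map_measure hg.aestronglyMeasurable hh.aemeasurable,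
    integrable_withDensity_iff_integrable_smul₀
      ((Lp.aestronglyMeasurable f).aemeasurable.nnnorm.pow_const 2)]
  rfl

end Intertwines

/-- The unitary `W` of `L²(μ)` onto `ℋ` carries multiplication by `h`, on its maximal domain, to
`H`. -/
structure IsMulRep (h : α → ℝ) (H : ℋ →ₗ.[ℂ] ℋ) (W : Lp ℂ 2 μ ≃ₗᵢ[ℂ] ℋ) : Prop where
  mem_domain_iff : ∀ f, W f ∈ H.domain ↔ MemLp (fun x => (h x : ℂ) * f x) 2 μ
  coeFn_symm_apply : ∀ (f : Lp ℂ 2 μ) (hf : W f ∈ H.domain),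
    W.symm (H ⟨W f, hf⟩) =ᵐ[μ] fun x => (h x : ℂ) * f x

variable {W : Lp ℂ 2 μ ≃ₗᵢ[ℂ] ℋ}

theorem IsMulRep.isSpectralMeasure (hW : IsMulRep h H W)
    (hE : Intertwines hh E W.toLinearIsometry) : IsSpectralMeasure H E := by
  refine ⟨fun ψ => ?_, fun ⟨ψ, hψ⟩ => ?_⟩ <;> obtain ⟨f, rfl⟩ := W.surjective ψ
  · have hm : AEStronglyMeasurable (fun x => (h x : ℂ) * f x) μ :=
      (Complex.measurable_ofReal.comp hh).aestronglyMeasurable.mul (Lp.aestronglyMeasurable f)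
    have hintegral := hE.integrable_vecMeasure_iff (continuous_pow 2).stronglyMeasurable f
    rw [W.coe_toLinearIsometry] at hintegral
    rw [hW.mem_domain_iff, hintegral, memLp_two_iff_integrable_sq_norm hm]
    simp [mul_pow, mul_comm]
  · have hintegral := hE.integral_vecMeasure stronglyMeasurable_id f
    rw [W.coe_toLinearIsometry] at hintegral
    simp only [id_eq] at hintegral
    rw [hintegral, ← integral_complex_ofReal, ← W.symm.inner_map_map, W.symm_apply_apply,
      L2.inner_def]
    refine integral_congr_ae ?_
    filter_upwards [hW.coeFn_symm_apply f hψ] with x hx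
    rw [hx, ← smul_eq_mul (h x : ℂ), inner_smul_right, inner_self_eq_norm_sq_to_K]
    simp [mul_comm]

open Classical in
/-- The projection-valued measure `B ↦ W 1_{h⁻¹(B)} W⁻¹`, for a unitary `W` of `L²(μ)` onto `ℋ`:
the spectral measure of the operator on `ℋ` that corresponds to multiplication by `h`. Sets that
are not Borel get the value `0`. -/
noncomputable def mulPVM (W : Lp ℂ 2 μ ≃ₗᵢ[ℂ] ℋ) {h : α → ℝ} (hh : Measurable h) : PVM ℋ where
  proj B := if hB : MeasurableSet B then W.conjStarAlgEquiv (indicatorOp (hh hB)) else 0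
  isProj B hB := by
    rw [dif_pos hB]
    exact (isStarProjection_indicatorOp (hh hB)).map _
  empty := by
    rw [dif_pos .empty]
    exact (congrArg W.conjStarAlgEquiv indicatorOp_empty).trans (map_zero _)
  univ := by
    rw [dif_pos .univ]
    exact (congrArg W.conjStarAlgEquiv indicatorOp_univ).trans (map_one _)
  inter A B hA hB := by
    rw [dif_pos hA, dif_pos hB, dif_pos (hA.inter hB), ← map_mul, indicatorOp_mul_indicatorOp]
    rfl
  hasSum B hB hdisj ψ := by
    simp only [dif_pos (hB _), dif_pos (MeasurableSet.iUnion hB), Set.preimage_iUnion,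
      LinearIsometryEquiv.conjStarAlgEquiv_apply_apply]
    exact W.toContinuousLinearEquiv.toContinuousLinearMap.hasSum
      (hasSum_indicatorOp (fun n => hh (hB n)) (fun m n hmn => (hdisj hmn).preimage h) (W.symm ψ))

theorem intertwines_mulPVM (W : Lp ℂ 2 μ ≃ₗᵢ[ℂ] ℋ) {h : α → ℝ} (hh : Measurable h) :
    Intertwines hh (mulPVM W hh) W.toLinearIsometry := fun B hB f => by
  simp [mulPVM, hB]

end MulRep

section Cyclic

variable {ℋ 𝒦 : Type*} [NormedAddCommGroup ℋ] [InnerProductSpace ℂ ℋ] [NormedAddCommGroup 𝒦]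
  [InnerProductSpace ℂ 𝒦] [CompleteSpace 𝒦] {H : ℋ →ₗ.[ℂ] ℋ}

theorem IsCyclicVector.surjective_of_mem_range {φ : ℋ} (hφ : IsCyclicVector H φ)
    {J : 𝒦 →ₗᵢ[ℂ] ℋ} (hJφ : φ ∈ LinearMap.range J.toLinearMap)
    (hJ : ∀ ψ : H.domain, (ψ : ℋ) ∈ LinearMap.range J.toLinearMap →
      H ψ ∈ LinearMap.range J.toLinearMap) : Function.Surjective J := by
  obtain ⟨-, x, hx_zero, hx_succ, hx_dense⟩ := hφ
  have hx : ∀ n, (x n : ℋ) ∈ LinearMap.range J.toLinearMap := by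
    intro n
    induction n with
    | zero => rwa [hx_zero]
    | succ n ih => exact hx_succ n ▸ hJ _ ih
  have hspan : (Submodule.span ℂ (Set.range fun n => (x n : ℋ)) : Set ℋ) ⊆ Set.range J :=
    Submodule.span_le.2 (Set.range_subset_iff.2 hx)
  have hclosed : IsClosed (Set.range J) := J.isometry.isClosedEmbedding.isClosed_range
  rw [← Set.range_eq_univ, ← Set.univ_subset_iff, ← hx_dense.closure_eq]
  exact closure_minimal hspan hclosed

end Cyclic

section MulX

variable {ℋ : Type*} [NormedAddCommGroup ℋ] [InnerProductSpace ℂ ℋ]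

theorem isMulRep_pullback_mulX {μ : Measure ℝ} (V : ℋ ≃ₗᵢ[ℂ] Lp ℂ 2 μ) :
    IsMulRep id (pullback V (mulX μ)) V.symm where
  mem_domain_iff f := by
    change V (V.symm f) ∈ (mulX μ).domain ↔ _
    rw [V.apply_symm_apply]
    rfl
  coeFn_symm_apply f hf := by
    change V (V.symm (mulX μ ⟨V (V.symm f), hf⟩)) =ᵐ[μ] _
    have hf' : f ∈ (mulX μ).domain := V.apply_symm_apply f ▸ hf
    simp only [V.apply_symm_apply]
    exact MemLp.coeFn_toLp hf'

end MulX

section SpectralRepresentation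

variable {ℋ 𝒦 : Type*} [NormedAddCommGroup ℋ] [InnerProductSpace ℂ ℋ] [CompleteSpace ℋ]
  [NormedAddCommGroup 𝒦] [InnerProductSpace ℂ 𝒦] [CompleteSpace 𝒦]
  {E : PVM ℋ} {H : ℋ →ₗ.[ℂ] ℋ}

theorem IsSpectralMeasure.unique {H' : ℋ →ₗ.[ℂ] ℋ} (hE : IsSpectralMeasure H E)
    (hE' : IsSpectralMeasure H' E) (hH : Dense (H.domain : Set ℋ)) : H = H' := by
  have hdom : H.domain = H'.domain := by
    ext ψ
    rw [hE.1, hE'.1]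
  refine LinearPMap.ext hdom fun ψ hψ hψ' => sub_eq_zero.1 ?_
  have hsub : Dense ((H - H').domain : Set ℋ) := by
    rwa [LinearPMap.sub_domain, ← hdom, inf_idem]
  refine apply_eq_zero_of_forall_inner_self (T := H - H') hsub (fun χ => ?_) ⟨ψ, hψ, hψ'⟩
  rw [LinearPMap.sub_apply, inner_sub_right, sub_eq_zero]
  exact (hE.2 ⟨χ, χ.2.1⟩).trans (hE'.2 ⟨χ, χ.2.2⟩).symm

theorem isSpectralMeasure_pullback {F : PVM 𝒦} {S : 𝒦 →ₗ.[ℂ] 𝒦} (hF : IsSpectralMeasure S F)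
    (V : ℋ ≃ₗᵢ[ℂ] 𝒦) (hV : ∀ B, MeasurableSet B → ∀ ψ, V (E.proj B ψ) = F.proj B (V ψ)) :
    IsSpectralMeasure (pullback V S) E := by
  have hvec : ∀ ψ, E.vecMeasure ψ = F.vecMeasure (V ψ) := by
    intro ψ
    ext B hB
    rw [E.vecMeasure_apply hB, F.vecMeasure_apply hB, ← hV B hB, V.enorm_map]
  refine ⟨fun ψ => by rw [hvec, ← hF.1]; rfl, fun ψ => ?_⟩
  rw [hvec, ← hF.2 ⟨V ψ, ψ.2⟩, ← V.symm.inner_map_map, V.symm_apply_apply]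
  rfl

theorem IsSpectralMeasure.apply_mem (hE : IsSpectralMeasure H E) (hH : Dense (H.domain : Set ℋ))
    {K : Submodule ℂ ℋ} [K.HasOrthogonalProjection]
    (hK : ∀ B, MeasurableSet B → ∀ ψ ∈ K, E.proj B ψ ∈ K) {ψ : H.domain} (hψ : (ψ : ℋ) ∈ K) :
    H ψ ∈ K := by
  have hperp : ∀ B, MeasurableSet B → ∀ ψ ∈ Kᗮ, E.proj B ψ ∈ Kᗮ := fun B hB ψ hψ χ hχ => by
    rw [← E.inner_proj_left hB]
    exact hψ _ (hK B hB χ hχ)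
  have hcomm : ∀ B, MeasurableSet B → ∀ χ,
      K.reflection (E.proj B χ) = E.proj B (K.reflection χ) := by
    intro B hB χ
    obtain ⟨y, hy, z, hz, rfl⟩ := K.exists_add_mem_mem_orthogonal χ
    simp only [map_add, K.reflection_mem_subspace_eq_self, hy, hK B hB,
      K.reflection_mem_subspace_orthogonalComplement_eq_neg, hz, hperp B hB, map_neg]
  have hpull : pullback K.reflection H = H :=
    (hE.unique (isSpectralMeasure_pullback hE K.reflection hcomm) hH).symm
  have hψK : K.reflection (ψ : ℋ) = ψ := K.reflection_mem_subspace_eq_self hψ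
  have hψU : K.reflection (ψ : ℋ) ∈ H.domain := hψK.symm ▸ ψ.2
  rw [← K.reflection_eq_self_iff]
  calc K.reflection (H ψ) = K.reflection.symm (H ⟨K.reflection ψ, hψU⟩) := by
        simp only [hψK, Submodule.reflection_symm]
    _ = H ψ := (LinearPMap.ext_iff.1 hpull).2 (hf := hψU) (hg := ψ.2)

/-- The unitary `V` is the inverse of `f ↦ f(H) φ`. -/
theorem exists_spectral_representation (hE : IsSpectralMeasure H E)
    (hH : Dense (H.domain : Set ℋ)) {φ : ℋ} (hφ : IsCyclicVector H φ) :
    ∃ V : ℋ ≃ₗᵢ[ℂ] Lp ℂ 2 (E.vecMeasure φ),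
      V φ =ᵐ[E.vecMeasure φ] (fun _ => 1) ∧ pullback V (mulX (E.vecMeasure φ)) = H ∧
        Intertwines measurable_id E V.symm.toLinearIsometry := by
  obtain ⟨J, hJφ, hJ⟩ := E.exists_intertwines φ
  have hrange : CompleteSpace (LinearMap.range J.toLinearMap) :=
    J.isometry.isUniformInducing.isComplete_range.completeSpace_coe
  have hsurj : Function.Surjective J :=
    hφ.surjective_of_mem_range ⟨_, hJφ⟩ fun ψ hψ => hE.apply_mem hH (by
      rintro B hB _ ⟨f, rfl⟩
      exact ⟨_, (hJ B hB f).symm⟩) hψ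
  let W := LinearIsometryEquiv.ofSurjective J hsurj
  have hW : Intertwines measurable_id E W.symm.symm.toLinearIsometry := hJ
  refine ⟨W.symm, ?_, ?_, hW⟩
  · rw [W.symm_apply_eq.2 hJφ.symm]
    exact Lp.coeFn_const 2 _ 1
  · exact (hE.unique ((isMulRep_pullback_mulX W.symm).isSpectralMeasure hW) hH).symm

end SpectralRepresentation

section Resolvent

variable {ℋ : Type*} [NormedAddCommGroup ℋ] [InnerProductSpace ℂ ℋ]
  {H : ℋ →ₗ.[ℂ] ℋ} {z w : ℂ} {R S : ℋ →L[ℂ] ℋ}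

/-- The bounded operator `R` is the resolvent `(H - z)⁻¹`. -/
structure IsResolvent (H : ℋ →ₗ.[ℂ] ℋ) (z : ℂ) (R : ℋ →L[ℂ] ℋ) : Prop where
  apply_mem : ∀ χ, R χ ∈ H.domain
  sub_smul_apply : ∀ χ, H ⟨R χ, apply_mem χ⟩ - z • R χ = χ
  apply_sub_smul : ∀ ψ : H.domain, R (H ψ - z • (ψ : ℋ)) = ψ

/-- The operator `H - z` as a bounded operator on the graph of `H`. -/
def graphSubSMul (H : ℋ →ₗ.[ℂ] ℋ) (z : ℂ) : H.graph →L[ℂ] ℋ :=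
  (ContinuousLinearMap.snd ℂ ℋ ℋ - z • ContinuousLinearMap.fst ℂ ℋ ℋ) ∘L H.graph.subtypeL

namespace IsResolvent

theorem injective (hR : IsResolvent H z R) : Function.Injective R := by
  refine (injective_iff_map_eq_zero R).2 fun χ hχ => ?_
  have hzero : (⟨R χ, hR.apply_mem χ⟩ : H.domain) = 0 := Subtype.ext hχ
  rw [← hR.sub_smul_apply χ, hzero, hχ, LinearPMap.map_zero, smul_zero, sub_zero]

theorem sub_eq (hR : IsResolvent H z R) (hS : IsResolvent H w S) :
    R - S = (z - w) • (R * S) := by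
  ext χ
  have hχ := hR.apply_sub_smul ⟨S χ, hS.apply_mem χ⟩
  have hshift : H ⟨S χ, hS.apply_mem χ⟩ - z • S χ = χ - (z - w) • S χ := by
    refine Eq.trans ?_ (congrArg (· - (z - w) • S χ) (hS.sub_smul_apply χ))
    module
  rw [hshift, map_sub, map_smul] at hχ
  calc R χ - S χ = R χ - (R χ - (z - w) • R (S χ)) := congrArg (R χ - ·) hχ.symm
    _ = (z - w) • R (S χ) := sub_sub_cancel _ _

theorem commute (hR : IsResolvent H z R) (hS : IsResolvent H w S) : Commute R S := by
  have h : (z - w) • (R * S) = (z - w) • (S * R) := by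
    rw [← hR.sub_eq hS, ← neg_sub S R, hS.sub_eq hR, ← neg_smul, neg_sub]
  rcases eq_or_ne z w with rfl | hzw
  · have hRS : R = S := by rw [← sub_eq_zero, hR.sub_eq hS, sub_self, zero_smul]
    rw [hRS]
  · exact smul_right_injective _ (sub_ne_zero.2 hzw) h

end IsResolvent

variable [CompleteSpace ℋ]

theorem inner_apply_of_isSelfAdjoint (hH : IsSelfAdjoint H) (x y : H.domain) :
    ⟪H x, (y : ℋ)⟫_ℂ = ⟪(x : ℋ), H y⟫_ℂ := by
  have h := LinearPMap.adjoint_isFormalAdjoint hH.dense_domain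
  rw [LinearPMap.isSelfAdjoint_def.1 hH] at h
  exact h x y

theorem mem_graph_of_forall_inner_eq (hH : IsSelfAdjoint H) {y v : ℋ}
    (h : ∀ x : H.domain, ⟪v, (x : ℋ)⟫_ℂ = ⟪y, H x⟫_ℂ) : (y, v) ∈ H.graph := by
  have hy : y ∈ H.adjoint.domain := H.mem_adjoint_domain_of_exists y ⟨v, h⟩
  rw [← LinearPMap.isSelfAdjoint_def.1 hH, LinearPMap.mem_graph_iff]
  exact ⟨⟨y, hy⟩, rfl, LinearPMap.adjoint_apply_eq hH.dense_domain ⟨y, hy⟩ h⟩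

theorem abs_im_mul_norm_le (hH : IsSelfAdjoint H) (z : ℂ) (x : H.domain) :
    |z.im| * ‖(x : ℋ)‖ ≤ ‖H x - z • (x : ℋ)‖ := by
  have him : (⟪(x : ℋ), H x⟫_ℂ).im = 0 := by
    rw [← Complex.conj_eq_iff_im, inner_conj_symm, inner_apply_of_isSelfAdjoint hH]
  have hinner : (⟪(x : ℋ), H x - z • (x : ℋ)⟫_ℂ).im = -(z.im * ‖(x : ℋ)‖ ^ 2) := by
    rw [inner_sub_right, inner_smul_right, inner_self_eq_norm_sq_to_K, Complex.sub_im, him,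
      zero_sub, RCLike.ofReal_eq_complex_ofReal, ← Complex.ofReal_pow, Complex.im_mul_ofReal]
  rcases eq_or_ne (x : ℋ) 0 with hx | hx
  · rw [hx, norm_zero, mul_zero]
    exact norm_nonneg _
  · refine le_of_mul_le_mul_left ?_ (norm_pos_iff.2 hx)
    calc ‖(x : ℋ)‖ * (|z.im| * ‖(x : ℋ)‖) = |(⟪(x : ℋ), H x - z • (x : ℋ)⟫_ℂ).im| := by
          rw [hinner, abs_neg, abs_mul, abs_of_nonneg (sq_nonneg ‖(x : ℋ)‖)]
          ring
      _ ≤ ‖⟪(x : ℋ), H x - z • (x : ℋ)⟫_ℂ‖ := Complex.abs_im_le_norm _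
      _ ≤ ‖(x : ℋ)‖ * ‖H x - z • (x : ℋ)‖ := norm_inner_le_norm _ _

theorem exists_antilipschitzWith_graphSubSMul (hH : IsSelfAdjoint H) (hz : z.im ≠ 0) :
    ∃ K, AntilipschitzWith K (graphSubSMul H z) := by
  refine ⟨⟨1 + (1 + ‖z‖) * |z.im|⁻¹, by positivity⟩,
    AddMonoidHomClass.antilipschitz_of_bound _ fun ⟨⟨x, y⟩, hxy⟩ => ?_⟩
  obtain ⟨ψ, rfl, rfl⟩ := (LinearPMap.mem_graph_iff H).1 hxy
  have hψ : ‖(ψ : ℋ)‖ ≤ |z.im|⁻¹ * ‖H ψ - z • (ψ : ℋ)‖ := by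
    rw [inv_mul_eq_div, le_div_iff₀' (abs_pos.2 hz)]
    exact abs_im_mul_norm_le hH z ψ
  have hHψ : ‖H ψ‖ ≤ ‖H ψ - z • (ψ : ℋ)‖ + ‖z‖ * ‖(ψ : ℋ)‖ := by
    rw [← norm_smul]
    exact norm_le_norm_sub_add _ _
  change max ‖(ψ : ℋ)‖ ‖H ψ‖ ≤ (1 + (1 + ‖z‖) * |z.im|⁻¹) * ‖H ψ - z • (ψ : ℋ)‖
  have := mul_le_mul_of_nonneg_left hψ (norm_nonneg z)
  have := norm_nonneg (H ψ - z • (ψ : ℋ))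
  have : 0 ≤ ‖z‖ * (|z.im|⁻¹ * ‖H ψ - z • (ψ : ℋ)‖) := by positivity
  refine max_le ?_ ?_ <;> nlinarith [norm_nonneg (ψ : ℋ)]

theorem range_graphSubSMul (hH : IsSelfAdjoint H) (hz : z.im ≠ 0) :
    (graphSubSMul H z).range = ⊤ := by
  have : CompleteSpace H.graph := hH.isClosed.completeSpace_coe
  obtain ⟨K, hK⟩ := exists_antilipschitzWith_graphSubSMul hH hz
  have : CompleteSpace (graphSubSMul H z).range :=
    (hK.isClosed_range (graphSubSMul H z).uniformContinuous).completeSpace_coe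
  rw [← Submodule.orthogonal_eq_bot_iff, Submodule.eq_bot_iff]
  intro y hy
  have hadj : (y, (starRingEnd ℂ) z • y) ∈ H.graph := by
    refine mem_graph_of_forall_inner_eq hH fun x => ?_
    have hx : ⟪y, H x - z • (x : ℋ)⟫_ℂ = 0 :=
      (Submodule.mem_orthogonal' _ y).1 hy _ ⟨⟨((x : ℋ), H x), H.mem_graph x⟩, rfl⟩
    rw [inner_sub_right, inner_smul_right, sub_eq_zero] at hx
    rw [inner_smul_left, Complex.conj_conj, hx]
  obtain ⟨x, hx, hHx⟩ := (LinearPMap.mem_graph_iff H).1 hadj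
  have hle := abs_im_mul_norm_le hH ((starRingEnd ℂ) z) x
  simp only at hx hHx
  rw [hHx, hx, sub_self, norm_zero, Complex.conj_im, abs_neg] at hle
  exact norm_le_zero_iff.1 (nonpos_of_mul_nonpos_right hle (abs_pos.2 hz))

theorem exists_isResolvent (hH : IsSelfAdjoint H) (hz : z.im ≠ 0) :
    ∃ R : ℋ →L[ℂ] ℋ, IsResolvent H z R := by
  have : CompleteSpace H.graph := hH.isClosed.completeSpace_coe
  obtain ⟨K, hK⟩ := exists_antilipschitzWith_graphSubSMul hH hz
  let e := ContinuousLinearEquiv.ofBijective (graphSubSMul H z)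
    (LinearMap.ker_eq_bot.2 hK.injective) (range_graphSubSMul hH hz)
  have hgraph : ∀ χ, ∃ ψ : H.domain, (e.symm χ : ℋ × ℋ) = (↑ψ, H ψ) := fun χ => by
    obtain ⟨ψ, h₁, h₂⟩ := (LinearPMap.mem_graph_iff H).1 (e.symm χ).2
    exact ⟨ψ, Prod.ext h₁.symm h₂.symm⟩
  refine ⟨ContinuousLinearMap.fst ℂ ℋ ℋ ∘L H.graph.subtypeL ∘L e.symm.toContinuousLinearMap,
    fun χ => ?_, fun χ => ?_, fun ψ => ?_⟩
  · obtain ⟨ψ, hψ⟩ := hgraph χ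
    change (e.symm χ : ℋ × ℋ).1 ∈ H.domain
    rw [hψ]
    exact ψ.2
  · obtain ⟨ψ, hψ⟩ := hgraph χ
    change H ⟨(e.symm χ : ℋ × ℋ).1, _⟩ - z • (e.symm χ : ℋ × ℋ).1 = χ
    calc _ = (e.symm χ : ℋ × ℋ).2 - z • (e.symm χ : ℋ × ℋ).1 := by simp only [hψ, Subtype.coe_eta]
      _ = e (e.symm χ) := rfl
      _ = χ := e.apply_symm_apply χ
  · change (e.symm (e ⟨((ψ : ℋ), H ψ), H.mem_graph ψ⟩) : ℋ × ℋ).1 = ψ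
    rw [e.symm_apply_apply]

namespace IsResolvent

theorem star_eq (hH : IsSelfAdjoint H) (hR : IsResolvent H z R)
    (hS : IsResolvent H ((starRingEnd ℂ) z) S) : star R = S := by
  rw [ContinuousLinearMap.star_eq_adjoint, eq_comm, ContinuousLinearMap.eq_adjoint_iff]
  intro a b
  have h := inner_apply_of_isSelfAdjoint hH ⟨S a, hS.apply_mem a⟩ ⟨R b, hR.apply_mem b⟩
  conv_lhs => rw [← hR.sub_smul_apply b]
  conv_rhs => rw [← hS.sub_smul_apply a]
  rw [inner_sub_right, inner_sub_left, inner_smul_right, inner_smul_left, Complex.conj_conj, h]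

theorem conj (hH : IsSelfAdjoint H) (hz : z.im ≠ 0) (hR : IsResolvent H z R) :
    IsResolvent H ((starRingEnd ℂ) z) (star R) := by
  obtain ⟨S, hS⟩ := exists_isResolvent hH (z := (starRingEnd ℂ) z)
    (by rwa [Complex.conj_im, neg_ne_zero])
  rwa [hR.star_eq hH hS]

end IsResolvent

end Resolvent

section RieszMarkov

variable {X : Type*} [TopologicalSpace X] [CompactSpace X] [MeasurableSpace X] [BorelSpace X]

theorem memLp_top_continuousMap {F : Type*} [NormedAddCommGroup F] (g : C(X, F)) (ν : Measure X) :
    MemLp g ∞ ν :=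
  g.continuous.memLp_top_of_hasCompactSupport (.of_compactSpace g) ν

theorem exists_measure_of_real_positive [T2Space X] (Λ : C(X, ℝ) →ₚ[ℝ] ℝ) :
    ∃ ν : Measure X, IsFiniteMeasure ν ∧ ν.WeaklyRegular ∧ ∀ f, Λ f = ∫ x, f x ∂ν := by
  let Λ' : CompactlySupportedContinuousMap X ℝ →ₚ[ℝ] ℝ := PositiveLinearMap.mk₀
    { toFun := fun f => Λ f.toContinuousMap
      map_add' := fun f g => map_add Λ _ _
      map_smul' := fun c f => map_smul Λ c _ } (fun f hf => Λ.map_nonneg hf)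
  exact ⟨RealRMK.rieszMeasure Λ', inferInstance, inferInstance, fun f =>
    (RealRMK.integral_rieszMeasure Λ'
      (CompactlySupportedContinuousMap.continuousMapEquiv f)).symm⟩

open scoped ComplexOrder in
theorem exists_measure_of_positive [T2Space X] (Λ : C(X, ℂ) →ₚ[ℂ] ℂ) :
    ∃ ν : Measure X, IsFiniteMeasure ν ∧ ν.WeaklyRegular ∧ ∀ f, Λ f = ∫ x, f x ∂ν := by
  let ι : C(X, ℝ) →L[ℝ] C(X, ℂ) := ContinuousLinearMap.compLeftContinuous ℝ X Complex.ofRealCLM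
  have hreal : ∀ f, (Λ (ι f)).im = 0 := fun f => by
    have hself : IsSelfAdjoint (ι f) := by
      ext x
      simp [ι]
    exact Complex.conj_eq_iff_im.1 (hself.map Λ)
  let Λre : C(X, ℝ) →ₗ[ℝ] ℝ := Complex.reLm ∘ₗ Λ.toLinearMap.restrictScalars ℝ ∘ₗ ι.toLinearMap
  obtain ⟨ν, hfin, hreg, hν⟩ := exists_measure_of_real_positive
    (PositiveLinearMap.mk₀ Λre fun f hf => by
      have hι : 0 ≤ ι f := fun x => Complex.zero_le_real.2 (hf x)
      exact (Complex.nonneg_iff.1 (Λ.map_nonneg hι)).1)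
  have hνι : ∀ f, Λ (ι f) = ((∫ x, f x ∂ν : ℝ) : ℂ) := fun f =>
    Complex.ext (hν f) (hreal f)
  refine ⟨ν, hfin, hreg, fun f => ?_⟩
  let u : C(X, ℝ) := ⟨fun x => (f x).re, by fun_prop⟩
  let v : C(X, ℝ) := ⟨fun x => (f x).im, by fun_prop⟩
  have hf : f = ι u + Complex.I • ι v := by
    ext x
    exact (Complex.re_add_im (f x)).symm.trans (by rw [mul_comm]; rfl)
  have hf_integrable : Integrable f ν := (memLp_top_continuousMap f ν).integrable le_top
  calc Λ f = ((∫ x, u x ∂ν : ℝ) : ℂ) + (∫ x, v x ∂ν : ℝ) * Complex.I := by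
        rw [hf, map_add, map_smul, hνι, hνι, smul_eq_mul, mul_comm]
    _ = ∫ x, f x ∂ν := integral_re_add_im hf_integrable

end RieszMarkov

section NormalOperator

variable {ℋ : Type*} [NormedAddCommGroup ℋ] [InnerProductSpace ℂ ℋ] [CompleteSpace ℋ]
  {R : ℋ →L[ℂ] ℋ} (hR : IsStarNormal R)

theorem inner_cfcHom_cfcHom (f g : C(spectrum ℂ R, ℂ)) (φ : ℋ) :
    ⟪cfcHom hR f φ, cfcHom hR g φ⟫_ℂ = ⟪φ, cfcHom hR (star f * g) φ⟫_ℂ := by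
  rw [map_mul, map_star, ContinuousLinearMap.star_eq_adjoint, mul_apply_eq_comp,
    ContinuousLinearMap.adjoint_inner_right]

open scoped ComplexOrder in
theorem exists_measure_inner_cfcHom (φ : ℋ) :
    ∃ ν : Measure (spectrum ℂ R), IsFiniteMeasure ν ∧ ν.WeaklyRegular ∧
      ∀ f, ⟪φ, cfcHom hR f φ⟫_ℂ = ∫ x, f x ∂ν := by
  let Λ : C(spectrum ℂ R, ℂ) →ₗ[ℂ] ℂ :=
    ((innerSL ℂ φ) ∘L (ContinuousLinearMap.apply ℂ ℋ φ)).toLinearMap ∘ₗ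
      (cfcHom hR).toAlgHom.toLinearMap
  have hpos : ∀ f, 0 ≤ f → 0 ≤ Λ f := fun f hf => by
    obtain ⟨g, rfl⟩ := CStarAlgebra.nonneg_iff_eq_star_mul_self.1 hf
    change 0 ≤ ⟪φ, cfcHom hR (star g * g) φ⟫_ℂ
    rw [← inner_cfcHom_cfcHom, inner_self_eq_norm_sq_to_K]
    exact pow_nonneg (RCLike.ofReal_nonneg.2 (norm_nonneg _)) 2
  exact exists_measure_of_positive (PositiveLinearMap.mk₀ Λ hpos)

theorem exists_isometry_cfcHom (φ : ℋ) :
    ∃ ν : Measure (spectrum ℂ R), IsFiniteMeasure ν ∧ ∃ J : Lp ℂ 2 ν →ₗᵢ[ℂ] ℋ,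
      φ ∈ LinearMap.range J.toLinearMap ∧ ∀ g f,
        cfcHom hR g (J f) = J (mulOp (memLp_top_continuousMap g ν) f) := by
  obtain ⟨ν, hfin, hreg, hν⟩ := exists_measure_inner_cfcHom hR φ
  have hdense : Dense (Submodule.span ℂ (Set.range (ContinuousMap.toLp (E := ℂ) 2 ν ℂ)) :
      Set (Lp ℂ 2 ν)) :=
    (ContinuousMap.toLp_denseRange ℂ ν ℂ (by simp)).mono Submodule.subset_span
  obtain ⟨J, hJ⟩ := exists_linearIsometry_of_inner_eq (w := fun f => cfcHom hR f φ) hdense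
    fun f g => by
      rw [inner_cfcHom_cfcHom, hν, ContinuousMap.inner_toLp]
      exact integral_congr_ae (.of_forall fun x => mul_comm _ _)
  have hmul : ∀ g f : C(spectrum ℂ R, ℂ), mulOp (memLp_top_continuousMap g ν)
      (ContinuousMap.toLp 2 ν ℂ f) = ContinuousMap.toLp 2 ν ℂ (g * f) := fun g f => by
    apply Lp.ext
    filter_upwards [coeFn_mulOp (memLp_top_continuousMap g ν) (ContinuousMap.toLp 2 ν ℂ f),
      ContinuousMap.coeFn_toLp (p := 2) (𝕜 := ℂ) ν f,
      ContinuousMap.coeFn_toLp (p := 2) (𝕜 := ℂ) ν (g * f)] with x hx hf hgf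
    rw [hx, hf, hgf, ContinuousMap.mul_apply]
  refine ⟨ν, hfin, J, ⟨ContinuousMap.toLp 2 ν ℂ 1, ?_⟩, fun g f => ?_⟩
  · exact (hJ 1).trans (by rw [map_one, one_apply_eq_self])
  · have hEq : (cfcHom hR g).comp J.toContinuousLinearMap =
        J.toContinuousLinearMap.comp (mulOp (memLp_top_continuousMap g ν)) := by
      refine ContinuousLinearMap.ext_on hdense ?_
      rintro _ ⟨f, rfl⟩
      simp only [ContinuousLinearMap.comp_apply, LinearIsometry.coe_toContinuousLinearMap, hmul,
        hJ, map_mul, mul_apply_eq_comp]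
    exact congr($hEq f)

end NormalOperator

section SpectralTheorem

theorem mul_re_sub_eq_one {x z : ℂ} (hx : x ≠ 0)
    (h : x - (starRingEnd ℂ) x = (z - (starRingEnd ℂ) z) * (x * (starRingEnd ℂ) x)) :
    x * (((z + x⁻¹).re : ℂ) - z) = 1 := by
  have hx' : (starRingEnd ℂ) x ≠ 0 := (map_ne_zero _).2 hx
  have hreal : (((z + x⁻¹).re : ℝ) : ℂ) = z + x⁻¹ := by
    rw [← Complex.conj_eq_iff_re, map_add, map_inv₀]
    field_simp
    linear_combination h
  rw [hreal, add_sub_cancel_left, mul_inv_cancel₀ hx]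

variable {ℋ : Type*} [NormedAddCommGroup ℋ] [InnerProductSpace ℂ ℋ] {H : ℋ →ₗ.[ℂ] ℋ} {z : ℂ}
  {R : ℋ →L[ℂ] ℋ}

theorem IsResolvent.isMulRep {α : Type*} [MeasurableSpace α] {μ : Measure α} {W : Lp ℂ 2 μ ≃ₗᵢ[ℂ] ℋ}
    {r : α → ℂ} {h : α → ℝ} (hR : IsResolvent H z R) (hr : MemLp r ∞ μ)
    (hRW : ∀ f, R (W f) = W (mulOp hr f)) (hrh : ∀ᵐ x ∂μ, r x * (h x - z) = 1) :
    IsMulRep h H W := by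
  have happly : ∀ (f : Lp ℂ 2 μ) (hf : W f ∈ H.domain),
      W.symm (H ⟨W f, hf⟩) =ᵐ[μ] fun x => (h x : ℂ) * f x := fun f hf => by
    set g := W.symm (H ⟨W f, hf⟩) with hg
    have hgf : mulOp hr (g - z • f) = f := W.injective <| by
      rw [← hRW, map_sub, map_smul, hg, W.apply_symm_apply]
      exact hR.apply_sub_smul ⟨W f, hf⟩
    filter_upwards [hgf ▸ coeFn_mulOp hr (g - z • f), Lp.coeFn_sub g (z • f), Lp.coeFn_smul z f,
      hrh] with x hx hsub hsmul hrx
    rw [hsub, Pi.sub_apply, hsmul, Pi.smul_apply, smul_eq_mul] at hx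
    linear_combination (z - h x) * hx - (g x - z * f x) * hrx
  refine ⟨fun f => ⟨fun hf => (memLp_congr_ae (happly f hf)).1 (Lp.memLp _), fun hf => ?_⟩, happly⟩
  have hfg : mulOp hr (hf.toLp _ - z • f) = f := Lp.ext <| by
    filter_upwards [coeFn_mulOp hr (hf.toLp _ - z • f), Lp.coeFn_sub (hf.toLp _) (z • f),
      Lp.coeFn_smul z f, hf.coeFn_toLp, hrh] with x hx hsub hsmul hhf hrx
    rw [hx, hsub, Pi.sub_apply, hsmul, Pi.smul_apply, smul_eq_mul, hhf]
    linear_combination f x * hrx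
  rw [← hfg, ← hRW]
  exact hR.apply_mem _

variable [CompleteSpace ℋ] {φ : ℋ}

namespace IsResolvent

theorem isStarNormal (hH : IsSelfAdjoint H) (hz : z.im ≠ 0) (hR : IsResolvent H z R) :
    IsStarNormal R :=
  ⟨(hR.conj hH hz).commute hR⟩

theorem sub_conj_of_mem_spectrum (hH : IsSelfAdjoint H) (hz : z.im ≠ 0)
    (hR : IsResolvent H z R) {x : ℂ} (hx : x ∈ spectrum ℂ R) :
    x - (starRingEnd ℂ) x = (z - (starRingEnd ℂ) z) * (x * (starRingEnd ℂ) x) := by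
  have hnormal := hR.isStarNormal hH hz
  let g : C(spectrum ℂ R, ℂ) := (ContinuousMap.id ℂ).restrict (spectrum ℂ R)
  have hg : cfcHom hnormal g = R := cfcHom_id hnormal
  have hid : g - star g = (z - (starRingEnd ℂ) z) • (g * star g) := by
    refine cfcHom_injective hnormal ?_
    rw [map_sub, map_smul, map_mul, map_star, hg]
    exact hR.sub_eq (hR.conj hH hz)
  exact congr($hid ⟨x, hx⟩)

theorem surjective_of_mem_range {𝒦 : Type*} [NormedAddCommGroup 𝒦] [InnerProductSpace ℂ 𝒦]
    [CompleteSpace 𝒦] (hR : IsResolvent H z R) (hφ : IsCyclicVector H φ) {J : 𝒦 →ₗᵢ[ℂ] ℋ}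
    (hJφ : φ ∈ LinearMap.range J.toLinearMap)
    (hRJ : ∀ f, R (J f) ∈ LinearMap.range J.toLinearMap)
    (hRJ' : ∀ f, star R (J f) ∈ LinearMap.range J.toLinearMap) : Function.Surjective J := by
  have : CompleteSpace (LinearMap.range J.toLinearMap) :=
    J.isometry.isUniformInducing.isComplete_range.completeSpace_coe
  refine hφ.surjective_of_mem_range hJφ fun ψ hψ => ?_
  have hmem : H ψ - z • (ψ : ℋ) ∈ LinearMap.range J.toLinearMap :=
    mem_of_apply_mem hR.injective (by rintro _ ⟨f, rfl⟩; exact hRJ f)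
      (by rintro _ ⟨f, rfl⟩; exact hRJ' f) (by rwa [hR.apply_sub_smul])
  simpa using Submodule.add_mem _ hmem (Submodule.smul_mem _ z hψ)

end IsResolvent

theorem exists_isSpectralMeasure (hH : IsSelfAdjoint H) (hφ : IsCyclicVector H φ) :
    ∃ E : PVM ℋ, IsSpectralMeasure H E := by
  have hI : Complex.I.im ≠ 0 := by simp
  obtain ⟨R, hR⟩ := exists_isResolvent hH hI
  have hnormal := hR.isStarNormal hH hI
  obtain ⟨ν, hν, J, hJφ, hJ⟩ := exists_isometry_cfcHom hnormal φ
  let g : C(spectrum ℂ R, ℂ) := (ContinuousMap.id ℂ).restrict (spectrum ℂ R)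
  have hg : cfcHom hnormal g = R := cfcHom_id hnormal
  have hRJ : ∀ f, R (J f) = J (mulOp (memLp_top_continuousMap g ν) f) := fun f => by
    rw [← hJ, hg]
  have hRJ' : ∀ f, star R (J f) = J (mulOp (memLp_top_continuousMap (star g) ν) f) := fun f => by
    rw [← hJ, map_star, hg]
  let W := LinearIsometryEquiv.ofSurjective J
    (hR.surjective_of_mem_range hφ hJφ (fun f => ⟨_, (hRJ f).symm⟩) fun f => ⟨_, (hRJ' f).symm⟩)
  have hinj : Function.Injective
      (mulOp (memLp_top_continuousMap g ν) : Lp ℂ 2 ν →L[ℂ] Lp ℂ 2 ν) := by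
    refine .of_comp (f := J) ?_
    simpa only [Function.comp_def, ← hRJ] using hR.injective.comp J.injective
  have hne : ∀ᵐ x ∂ν, g x ≠ 0 :=
    ae_ne_zero_of_mulOp_injective g.continuous.measurable (memLp_top_continuousMap g ν) hinj
  let h : spectrum ℂ R → ℝ := fun x => (Complex.I + (x : ℂ)⁻¹).re
  have hh : Measurable h :=
    Complex.measurable_re.comp (measurable_subtype_coe.inv.const_add Complex.I)
  have hW : IsMulRep h H W := hR.isMulRep (memLp_top_continuousMap g ν) hRJ <| by
    filter_upwards [hne] with x hx
    exact mul_re_sub_eq_one hx (hR.sub_conj_of_mem_spectrum hH hI x.2)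
  exact ⟨mulPVM W hh, hW.isSpectralMeasure (intertwines_mulPVM W hh)⟩

theorem isSpectralMeasure_spectralMeasure (hH : IsSelfAdjoint H) (hφ : IsCyclicVector H φ) :
    IsSpectralMeasure H (spectralMeasure H) := by
  have h := exists_isSpectralMeasure hH hφ
  rw [spectralMeasure, dif_pos h]
  exact h.choose_spec

end SpectralTheorem

section Fourier

variable {V : Type*} [NormedAddCommGroup V] [InnerProductSpace ℝ V] [MeasurableSpace V]
  {μ : Measure V}

theorem charFun_withDensity_ofReal {u : V → ℝ} (hu : AEMeasurable u μ) (hu0 : 0 ≤ᵐ[μ] u) (t : V) :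
    charFun (μ.withDensity fun x => ENNReal.ofReal (u x)) t =
      ∫ x, Complex.exp (⟪x, t⟫_ℝ * Complex.I) * u x ∂μ := by
  rw [charFun_apply, integral_withDensity_eq_integral_toReal_smul₀ hu.ennreal_ofReal
    (.of_forall fun x => ENNReal.ofReal_lt_top)]
  refine integral_congr_ae ?_
  filter_upwards [hu0] with x hx
  rw [ENNReal.toReal_ofReal hx, Complex.real_smul, mul_comm]

theorem integral_exp_inner_mul_conj (g : V → ℂ) (t : V) :
    ∫ x, Complex.exp (⟪x, t⟫_ℝ * Complex.I) * starRingEnd ℂ (g x) ∂μ =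
      starRingEnd ℂ (∫ x, Complex.exp (⟪x, -t⟫_ℝ * Complex.I) * g x ∂μ) := by
  rw [← integral_conj]
  simp [← Complex.exp_conj]

variable [BorelSpace V] [SecondCountableTopology V]

theorem integrable_exp_inner_mul {g : V → ℂ} (hg : Integrable g μ) (t : V) :
    Integrable (fun x => Complex.exp (⟪x, t⟫_ℝ * Complex.I) * g x) μ :=
  hg.bdd_mul (c := 1) (by fun_prop) (.of_forall fun x => (Complex.norm_exp_ofReal_mul_I _).le)

variable [CompleteSpace V]

theorem ae_eq_of_integral_exp_inner_mul_eq {u v : V → ℝ} (hu : Integrable u μ)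
    (hv : Integrable v μ) (hu0 : 0 ≤ᵐ[μ] u) (hv0 : 0 ≤ᵐ[μ] v)
    (h : ∀ t : V, ∫ x, Complex.exp (⟪x, t⟫_ℝ * Complex.I) * u x ∂μ =
      ∫ x, Complex.exp (⟪x, t⟫_ℝ * Complex.I) * v x ∂μ) : u =ᵐ[μ] v := by
  have := isFiniteMeasure_withDensity_ofReal hu.2
  have := isFiniteMeasure_withDensity_ofReal hv.2
  have hum := hu.1.aemeasurable
  have hvm := hv.1.aemeasurable
  have h_withDensity : μ.withDensity (fun x => ENNReal.ofReal (u x)) =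
      μ.withDensity fun x => ENNReal.ofReal (v x) := by
    refine Measure.ext_of_charFun (funext fun t => ?_)
    rw [charFun_withDensity_ofReal hum hu0, charFun_withDensity_ofReal hvm hv0, h]
  filter_upwards [(withDensity_eq_iff hum.ennreal_ofReal hvm.ennreal_ofReal
    hu.lintegral_lt_top.ne).1 h_withDensity, hu0, hv0] with x hx hux hvx
  exact (ENNReal.ofReal_eq_ofReal_iff hux hvx).1 hx

theorem ae_eq_zero_of_integral_exp_inner_mul_ofReal {u : V → ℝ} (hu : Integrable u μ)
    (h : ∀ t : V, ∫ x, Complex.exp (⟪x, t⟫_ℝ * Complex.I) * u x ∂μ = 0) : u =ᵐ[μ] 0 := by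
  have h_parts : (fun x => max (u x) 0) =ᵐ[μ] fun x => max (-u x) 0 := by
    refine ae_eq_of_integral_exp_inner_mul_eq hu.pos_part hu.neg_part
      (.of_forall fun x => le_max_right _ _) (.of_forall fun x => le_max_right _ _) fun t => ?_
    rw [← sub_eq_zero, ← integral_sub (integrable_exp_inner_mul (g := fun x => (max (u x) 0 : ℝ))
        hu.pos_part.ofReal t)
      (integrable_exp_inner_mul (g := fun x => (max (-u x) 0 : ℝ)) hu.neg_part.ofReal t), ← h t]
    refine integral_congr_ae (.of_forall fun x => ?_)
    dsimp only
    rw [← mul_sub, ← Complex.ofReal_sub, max_zero_sub_max_neg_zero_eq_self]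
  filter_upwards [h_parts] with x hx
  rw [← max_zero_sub_max_neg_zero_eq_self (u x), hx, sub_self, Pi.zero_apply]

theorem ae_eq_zero_of_integral_exp_inner_mul {g : V → ℂ} (hg : Integrable g μ)
    (h : ∀ t : V, ∫ x, Complex.exp (⟪x, t⟫_ℝ * Complex.I) * g x ∂μ = 0) : g =ᵐ[μ] 0 := by
  have hgc : Integrable (fun x => starRingEnd ℂ (g x)) μ :=
    memLp_one_iff_integrable.1 (memLp_one_iff_integrable.2 hg).star
  have h_re (c : ℂ) : (fun x => (c * g x).re) =ᵐ[μ] 0 := by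
    refine ae_eq_zero_of_integral_exp_inner_mul_ofReal (hg.const_mul c).re fun t => ?_
    have h_split : ∀ x, Complex.exp (⟪x, t⟫_ℝ * Complex.I) * ((c * g x).re : ℂ) =
        c / 2 * (Complex.exp (⟪x, t⟫_ℝ * Complex.I) * g x) + starRingEnd ℂ c / 2 *
          (Complex.exp (⟪x, t⟫_ℝ * Complex.I) * starRingEnd ℂ (g x)) := fun x => by
      rw [Complex.re_eq_add_conj, map_mul]
      ring
    simp_rw [h_split]
    rw [integral_add ((integrable_exp_inner_mul hg t).const_mul _)
        ((integrable_exp_inner_mul hgc t).const_mul _), integral_const_mul, integral_const_mul,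
      integral_exp_inner_mul_conj, h, h, map_zero, mul_zero, mul_zero, add_zero]
  filter_upwards [h_re 1, h_re (-Complex.I)] with x hre him
  exact Complex.ext (by simpa using hre) (by simpa using him)

theorem dense_of_exp_inner_mem [IsFiniteMeasure μ] (S : Submodule ℂ (Lp ℂ 2 μ))
    (hS : ∀ t : V, ∃ f ∈ S, f =ᵐ[μ] fun x => Complex.exp (⟪x, t⟫_ℝ * Complex.I)) :
    Dense (S : Set (Lp ℂ 2 μ)) := by
  rw [Submodule.dense_iff_topologicalClosure_eq_top, Submodule.topologicalClosure_eq_top_iff,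
    Submodule.eq_bot_iff]
  intro g hg
  have hgc : Integrable (fun x => starRingEnd ℂ (g x)) μ :=
    (Lp.memLp g).star.integrable one_le_two
  have h_conj := ae_eq_zero_of_integral_exp_inner_mul hgc fun t => by
    obtain ⟨f, hf, hfe⟩ := hS t
    rw [← (Submodule.mem_orthogonal' S g).1 hg f hf, L2.inner_def]
    refine integral_congr_ae ?_
    filter_upwards [hfe] with x hx
    rw [hx, RCLike.inner_apply]
  rw [Lp.eq_zero_iff_ae_eq_zero]
  filter_upwards [h_conj] with x hx
  simpa using hx

end Fourier

section Exponentials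

theorem hasDerivAt_exp_I_mul (t x : ℝ) :
    HasDerivAt (fun x : ℝ => Complex.exp (Complex.I * t * x))
      (Complex.I * t * Complex.exp (Complex.I * t * x)) x := by
  have h_mul : HasDerivAt (fun y : ℝ => Complex.I * t * (y : ℂ)) (Complex.I * t) x := by
    simpa using (Complex.ofRealCLM.hasDerivAt (x := x)).const_mul (Complex.I * t)
  simpa only [mul_comm] using h_mul.cexp

theorem exp_mem_expSpan (t : ℝ) : (fun x : ℝ => Complex.exp (Complex.I * t * x)) ∈ expSpan :=
  Submodule.subset_span ⟨t, rfl⟩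

theorem exp_neg_mem_expSpan (t : ℝ) :
    (fun x : ℝ => Complex.exp (-(Complex.I * t * x))) ∈ expSpan := by
  simpa using exp_mem_expSpan (-t)

theorem deriv_mem_expSpan {F : ℝ → ℂ} (hF : F ∈ expSpan) : deriv F ∈ expSpan := by
  unfold expSpan at hF
  induction hF using Submodule.span_induction with
  | mem F h =>
    obtain ⟨t, rfl⟩ := h
    rw [funext fun x => (hasDerivAt_exp_I_mul t x).deriv]
    exact Submodule.smul_mem _ (Complex.I * t) (exp_mem_expSpan t)
  | zero =>
    rw [deriv_zero]
    exact Submodule.zero_mem _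
  | add F G hF hG hF' hG' =>
    rw [show deriv (F + G) = deriv F + deriv G from funext fun x =>
      deriv_add (differentiable_of_mem_expSpan hF x) (differentiable_of_mem_expSpan hG x)]
    exact Submodule.add_mem _ hF' hG'
  | smul c F hF hF' =>
    rw [show deriv (c • F) = c • deriv F from funext fun x =>
      deriv_const_smul c (differentiable_of_mem_expSpan hF x)]
    exact Submodule.smul_mem _ c hF'

theorem mul_mem_expSpan {F G : ℝ → ℂ} (hF : F ∈ expSpan) (hG : G ∈ expSpan) :
    F * G ∈ expSpan := by
  have h_le : expSpan * expSpan ≤ expSpan := by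
    rw [expSpan, Submodule.span_mul_span, Submodule.span_le]
    rintro _ ⟨_, ⟨s, rfl⟩, _, ⟨t, rfl⟩, rfl⟩
    refine (congrArg (· ∈ expSpan) (funext fun x => ?_)).mp (exp_mem_expSpan (s + t))
    simp only [Pi.mul_apply, ← Complex.exp_add, Complex.ofReal_add]
    ring_nf
  exact h_le (Submodule.mul_mem_mul hF hG)

theorem star_mem_expSpan {F : ℝ → ℂ} (hF : F ∈ expSpan) : star F ∈ expSpan := by
  unfold expSpan at hF
  induction hF using Submodule.span_induction with
  | mem F h =>
    obtain ⟨t, rfl⟩ := h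
    convert exp_neg_mem_expSpan t using 2 with x
    simp [← Complex.exp_conj]
  | zero => simp
  | add F G _ _ hF hG =>
    rw [star_add]
    exact Submodule.add_mem _ hF hG
  | smul c F _ hF =>
    rw [star_smul]
    exact Submodule.smul_mem _ _ hF

theorem memLp_top_of_mem_expSpan {μ : Measure ℝ} {F : ℝ → ℂ} (hF : F ∈ expSpan) :
    MemLp F ∞ μ := by
  unfold expSpan at hF
  induction hF using Submodule.span_induction with
  | mem F h =>
    obtain ⟨t, rfl⟩ := h
    refine memLp_top_of_bound (by fun_prop) 1 (.of_forall fun x => ?_)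
    dsimp only
    rw [mul_assoc, mul_comm, ← Complex.ofReal_mul, Complex.norm_exp_ofReal_mul_I]
  | zero => exact MemLp.zero'
  | add F G _ _ hF hG => exact hF.add hG
  | smul c F _ hF => exact hF.const_smul c

/-- The unitary `e^{-itX}` in `L²(μ)`, where `X` is multiplication by `λ`. -/
noncomputable def evolution (μ : Measure ℝ) (t : ℝ) : Lp ℂ 2 μ →L[ℂ] Lp ℂ 2 μ :=
  mulOp (memLp_top_of_mem_expSpan (exp_neg_mem_expSpan t))

theorem coeFn_evolution {μ : Measure ℝ} (t : ℝ) (f : Lp ℂ 2 μ) :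
    evolution μ t f =ᵐ[μ] fun x => Complex.exp (-(Complex.I * t * x)) * f x :=
  coeFn_mulOp _ f

/-- The function `i F' + (i/2) W F`. -/
noncomputable def timeFun (ρ : ℝ → ℝ) (F : ℝ → ℂ) (x : ℝ) : ℂ :=
  Complex.I * deriv F x + Complex.I / 2 * (logSlope ρ x : ℂ) * F x

theorem timeFun_exp_neg_mul (ρ : ℝ → ℝ) (t : ℝ) {F : ℝ → ℂ} {x : ℝ}
    (hF : DifferentiableAt ℝ F x) :
    timeFun ρ ((fun x : ℝ => Complex.exp (-(Complex.I * t * x))) * F) x =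
      Complex.exp (-(Complex.I * t * x)) * (timeFun ρ F x + t * F x) := by
  have h_exp : HasDerivAt (fun x : ℝ => Complex.exp (-(Complex.I * t * x)))
      (-(Complex.I * t) * Complex.exp (-(Complex.I * t * x))) x := by
    simpa using hasDerivAt_exp_I_mul (-t) x
  rw [timeFun, timeFun, (h_exp.mul hF.hasDerivAt).deriv, Pi.mul_apply]
  linear_combination (-t * Complex.exp (-(Complex.I * t * x)) * F x) * Complex.I_sq

theorem evolution_mem_timeGraph {μ : Measure ℝ} {ρ : ℝ → ℝ} {p : Lp ℂ 2 μ × Lp ℂ 2 μ}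
    (hp : p ∈ timeGraph μ ρ) (t : ℝ) :
    (evolution μ t p.1, evolution μ t (p.2 + (t : ℂ) • p.1)) ∈ timeGraph μ ρ := by
  obtain ⟨F, hF, hpF, hpF'⟩ := hp
  refine ⟨_, mul_mem_expSpan (exp_neg_mem_expSpan t) hF, ?_, ?_⟩
  · filter_upwards [coeFn_evolution t p.1, hpF] with x hx hFx
    rw [hx, hFx, Pi.mul_apply]
  · filter_upwards [coeFn_evolution t (p.2 + (t : ℂ) • p.1), hpF, hpF',
      Lp.coeFn_add p.2 ((t : ℂ) • p.1), Lp.coeFn_smul (t : ℂ) p.1] with x hx hFx hFx' hadd hsmul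
    rw [hx, hadd, Pi.add_apply, hsmul, Pi.smul_apply, hFx, hFx', smul_eq_mul]
    exact (timeFun_exp_neg_mul ρ t (differentiable_of_mem_expSpan hF x)).symm

end Exponentials

section FisherDensity

/-- The measure with density `ρ` with respect to Lebesgue measure. -/
noncomputable abbrev densityMeasure (ρ : ℝ → ℝ) : Measure ℝ :=
  volume.withDensity fun x => ENNReal.ofReal (ρ x)

/-- A differentiable integrable density on `ℝ` with finite Fisher information `∫ ρ'² / ρ`. -/
structure IsFisherDensity (ρ : ℝ → ℝ) : Prop where
  nonneg : ∀ x, 0 ≤ ρ x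
  differentiable : Differentiable ℝ ρ
  integrable : Integrable ρ
  fisher : IntegrableOn (fun x => deriv ρ x ^ 2 / ρ x) {x | 0 < ρ x}

theorem measurable_logSlope {ρ : ℝ → ℝ} (hρ : Measurable ρ) : Measurable (logSlope ρ) :=
  Measurable.ite (measurableSet_lt measurable_const hρ) ((measurable_deriv ρ).div hρ)
    measurable_const

namespace IsFisherDensity

variable {ρ : ℝ → ℝ} (hρ : IsFisherDensity ρ)

include hρ

theorem isFiniteMeasure : IsFiniteMeasure (densityMeasure ρ) :=
  isFiniteMeasure_withDensity_ofReal hρ.integrable.2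

theorem measurable : Measurable ρ := hρ.differentiable.continuous.measurable

-- At a zero of `ρ` the derivative vanishes too, since `ρ` is minimal there.
theorem logSlope_mul_self (x : ℝ) : logSlope ρ x * ρ x = deriv ρ x := by
  unfold logSlope
  split_ifs with h
  · exact div_mul_cancel₀ _ h.ne'
  · have h_zero : ρ x = 0 := le_antisymm (not_lt.1 h) (hρ.nonneg x)
    have h_min : IsLocalMin ρ x := .of_forall fun y => h_zero ▸ hρ.nonneg y
    rw [zero_mul, h_min.deriv_eq_zero]

section

variable {F : Type*} [NormedAddCommGroup F] [NormedSpace ℝ F]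

theorem integrable_densityMeasure_iff (g : ℝ → F) :
    Integrable g (densityMeasure ρ) ↔ Integrable fun x => ρ x • g x := by
  rw [integrable_withDensity_iff_integrable_smul' hρ.measurable.ennreal_ofReal
    (.of_forall fun x => ENNReal.ofReal_lt_top)]
  simp only [ENNReal.toReal_ofReal (hρ.nonneg _)]

theorem integral_densityMeasure (g : ℝ → F) :
    ∫ x, g x ∂(densityMeasure ρ) = ∫ x, ρ x • g x := by
  rw [integral_withDensity_eq_integral_toReal_smul hρ.measurable.ennreal_ofReal
    (.of_forall fun x => ENNReal.ofReal_lt_top)]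
  simp only [ENNReal.toReal_ofReal (hρ.nonneg _)]

/-- Integration by parts: `-(d/dλ + W)` is the formal adjoint of `d/dλ` in `L²(ρ dλ)`. -/
theorem integral_deriv_add_logSlope_smul_eq_zero {u : ℝ → F} (hu : Differentiable ℝ u)
    (hui : Integrable u (densityMeasure ρ))
    (hui' : Integrable (fun x => deriv u x + logSlope ρ x • u x) (densityMeasure ρ)) :
    ∫ x, deriv u x + logSlope ρ x • u x ∂(densityMeasure ρ) = 0 := by
  rw [hρ.integrable_densityMeasure_iff] at hui hui'
  rw [hρ.integral_densityMeasure]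
  refine integral_eq_zero_of_hasDerivAt_of_integrable (fun x => ?_) hui' hui
  refine ((hρ.differentiable x).hasDerivAt.smul (hu x).hasDerivAt).congr_deriv ?_
  rw [← hρ.logSlope_mul_self x, smul_add, smul_smul, mul_comm]

end

theorem memLp_logSlope : MemLp (fun x => (logSlope ρ x : ℂ)) 2 (densityMeasure ρ) := by
  refine MemLp.ofReal (f := logSlope ρ) ?_
  rw [memLp_two_iff_integrable_sq (measurable_logSlope hρ.measurable).aestronglyMeasurable,
    hρ.integrable_densityMeasure_iff]
  refine ((integrable_indicator_iff (measurableSet_lt measurable_const hρ.measurable)).2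
    hρ.fisher).congr (.of_forall fun x => ?_)
  by_cases h : 0 < ρ x
  · simp only [Set.indicator_of_mem (show x ∈ {x | 0 < ρ x} from h), logSlope, h, if_true,
      smul_eq_mul]
    field_simp
  · simp [logSlope, h]

theorem memLp_of_mem_expSpan {F : ℝ → ℂ} (hF : F ∈ expSpan) : MemLp F 2 (densityMeasure ρ) :=
  have := hρ.isFiniteMeasure
  (memLp_top_of_mem_expSpan hF).mono_exponent le_top

theorem memLp_logSlope_mul {F : ℝ → ℂ} (hF : F ∈ expSpan) :
    MemLp (fun x => (logSlope ρ x : ℂ) * F x) 2 (densityMeasure ρ) :=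
  (memLp_top_of_mem_expSpan hF).mul' hρ.memLp_logSlope

theorem memLp_timeFun {F : ℝ → ℂ} (hF : F ∈ expSpan) :
    MemLp (timeFun ρ F) 2 (densityMeasure ρ) := by
  refine (((hρ.memLp_of_mem_expSpan (deriv_mem_expSpan hF)).const_mul Complex.I).add
    ((hρ.memLp_logSlope_mul hF).const_mul (Complex.I / 2))).ae_eq (.of_forall fun x => ?_)
  simp only [timeFun, Pi.add_apply, mul_assoc]

theorem integral_deriv_add_logSlope_mul_eq_zero {u : ℝ → ℂ} (hu : u ∈ expSpan) :
    ∫ x, deriv u x + logSlope ρ x * u x ∂(densityMeasure ρ) = 0 := by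
  have := hρ.isFiniteMeasure
  have h_deriv := (hρ.memLp_of_mem_expSpan (deriv_mem_expSpan hu)).integrable one_le_two
  refine hρ.integral_deriv_add_logSlope_smul_eq_zero (differentiable_of_mem_expSpan hu)
    ((hρ.memLp_of_mem_expSpan hu).integrable one_le_two) ?_
  exact h_deriv.add ((hρ.memLp_logSlope_mul hu).integrable one_le_two)

theorem eqOn_zero_of_ae_eq_zero {F : ℝ → ℂ} (hF : Continuous F) (h : F =ᵐ[densityMeasure ρ] 0) :
    Set.EqOn F 0 {x | 0 < ρ x} := by
  have h_open : IsOpen {x | 0 < ρ x} :=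
    isOpen_lt continuous_const hρ.differentiable.continuous
  have h_ae : ∀ᵐ x ∂(volume.restrict {x | 0 < ρ x}), F x = 0 := by
    rw [ae_restrict_iff' h_open.measurableSet]
    filter_upwards [(ae_withDensity_iff hρ.measurable.ennreal_ofReal).1 h] with x hx hpos
    exact hx (by simpa using hpos)
  exact Measure.eqOn_open_of_ae_eq h_ae h_open hF.continuousOn continuousOn_const

theorem timeFun_ae_eq_zero {F : ℝ → ℂ} (hF : Continuous F) (h : F =ᵐ[densityMeasure ρ] 0) :
    timeFun ρ F =ᵐ[densityMeasure ρ] 0 := by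
  have h_eqOn := hρ.eqOn_zero_of_ae_eq_zero hF h
  refine (ae_withDensity_iff hρ.measurable.ennreal_ofReal).2 (.of_forall fun x hx => ?_)
  have h_pos : 0 < ρ x := by simpa using hx
  have h_deriv : deriv F x = 0 := by
    have h_nhds : {x | 0 < ρ x} ∈ 𝓝 x :=
      (isOpen_lt continuous_const hρ.differentiable.continuous).mem_nhds h_pos
    rw [(h_eqOn.eventuallyEq_of_mem h_nhds).deriv_eq]
    exact deriv_const x 0
  simp [timeFun, h_deriv, h_eqOn h_pos]

theorem snd_eq_zero_of_mem_timeGraph {p : Lp ℂ 2 (densityMeasure ρ) × Lp ℂ 2 (densityMeasure ρ)}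
    (hp : p ∈ timeGraph (densityMeasure ρ) ρ) (h : p.1 = 0) : p.2 = 0 := by
  obtain ⟨F, hF, hpF, hpF'⟩ := hp
  rw [Lp.eq_zero_iff_ae_eq_zero] at h ⊢
  exact hpF'.trans <| hρ.timeFun_ae_eq_zero (differentiable_of_mem_expSpan hF).continuous
    (hpF.symm.trans h)

theorem timeOp_graph : (timeOp (densityMeasure ρ) ρ).graph = timeGraph (densityMeasure ρ) ρ :=
  Submodule.toLinearPMap_graph_eq _ fun _ => hρ.snd_eq_zero_of_mem_timeGraph

theorem mem_timeGraph (f : (timeOp (densityMeasure ρ) ρ).domain) :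
    ((f : Lp ℂ 2 (densityMeasure ρ)), timeOp (densityMeasure ρ) ρ f) ∈
      timeGraph (densityMeasure ρ) ρ :=
  hρ.timeOp_graph ▸ LinearPMap.mem_graph _ f

theorem exists_mem_domain_timeOp {F : ℝ → ℂ} (hF : F ∈ expSpan) :
    ∃ f ∈ (timeOp (densityMeasure ρ) ρ).domain, f =ᵐ[densityMeasure ρ] F := by
  have h_graph : ((hρ.memLp_of_mem_expSpan hF).toLp F, (hρ.memLp_timeFun hF).toLp _) ∈
      timeGraph (densityMeasure ρ) ρ :=
    ⟨F, hF, (hρ.memLp_of_mem_expSpan hF).coeFn_toLp, (hρ.memLp_timeFun hF).coeFn_toLp⟩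
  exact ⟨_, Submodule.mem_map_of_mem (f := LinearMap.fst ℂ _ _) h_graph,
    (hρ.memLp_of_mem_expSpan hF).coeFn_toLp⟩

theorem inner_eq_of_mem_timeGraph {p q : Lp ℂ 2 (densityMeasure ρ) × Lp ℂ 2 (densityMeasure ρ)}
    (hp : p ∈ timeGraph (densityMeasure ρ) ρ) (hq : q ∈ timeGraph (densityMeasure ρ) ρ) :
    ⟪p.2, q.1⟫_ℂ = ⟪p.1, q.2⟫_ℂ := by
  obtain ⟨F, hF, hpF, hpF'⟩ := hp
  obtain ⟨G, hG, hqG, hqG'⟩ := hq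
  have h_deriv (x : ℝ) : deriv (star F * G) x =
      starRingEnd ℂ (deriv F x) * G x + starRingEnd ℂ (F x) * deriv G x :=
    ((differentiable_of_mem_expSpan hF x).hasDerivAt.star.mul
      (differentiable_of_mem_expSpan hG x).hasDerivAt).deriv
  have h_parts : ∫ x, (⟪p.1 x, q.2 x⟫_ℂ - ⟪p.2 x, q.1 x⟫_ℂ) ∂(densityMeasure ρ) =
      ∫ x, Complex.I * (deriv (star F * G) x + logSlope ρ x * (star F * G) x)
        ∂(densityMeasure ρ) := by
    refine integral_congr_ae ?_
    filter_upwards [hpF, hpF', hqG, hqG'] with x h1 h2 h3 h4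
    simp only [h1, h2, h3, h4, h_deriv, RCLike.inner_apply, map_add, map_mul, map_div₀,
      Complex.conj_I, Complex.conj_ofReal, map_ofNat, Pi.mul_apply, Pi.star_apply, RCLike.star_def]
    ring
  rw [eq_comm, ← sub_eq_zero, L2.inner_def, L2.inner_def,
    ← integral_sub (L2.integrable_inner _ _) (L2.integrable_inner _ _), h_parts,
    integral_const_mul, hρ.integral_deriv_add_logSlope_mul_eq_zero
      (mul_mem_expSpan (star_mem_expSpan hF) hG), mul_zero]

theorem isSymmetricOp_timeOp : IsSymmetricOp (timeOp (densityMeasure ρ) ρ) := by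
  have := hρ.isFiniteMeasure
  refine ⟨dense_of_exp_inner_mem _ fun t => ?_,
    fun f g => hρ.inner_eq_of_mem_timeGraph (hρ.mem_timeGraph f) (hρ.mem_timeGraph g)⟩
  convert hρ.exists_mem_domain_timeOp (exp_mem_expSpan t) using 6 with f x
  rw [RCLike.inner_apply, conj_trivial, Complex.ofReal_mul]
  ring

theorem timeOp_evolution (t : ℝ) (f : (timeOp (densityMeasure ρ) ρ).domain) :
    ∃ h : evolution _ t f ∈ (timeOp (densityMeasure ρ) ρ).domain,
      timeOp (densityMeasure ρ) ρ ⟨evolution _ t f, h⟩ =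
        evolution _ t (timeOp (densityMeasure ρ) ρ f + (t : ℂ) • (f : Lp ℂ 2 _)) := by
  have h_graph := evolution_mem_timeGraph (hρ.mem_timeGraph f) t
  rw [← hρ.timeOp_graph] at h_graph
  have h_mem := LinearPMap.mem_domain_of_mem_graph h_graph
  exact ⟨h_mem, LinearPMap.mem_graph_snd_inj _ (LinearPMap.mem_graph _ ⟨_, h_mem⟩) h_graph rfl⟩

end IsFisherDensity

end FisherDensity

section StrongTimeOperator

variable {ℋ : Type*} [NormedAddCommGroup ℋ] [InnerProductSpace ℂ ℋ]

theorem isSymmetricOp_pullback {𝒦 : Type*} [NormedAddCommGroup 𝒦] [InnerProductSpace ℂ 𝒦]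
    {S : 𝒦 →ₗ.[ℂ] 𝒦} (hS : IsSymmetricOp S) (V : ℋ ≃ₗᵢ[ℂ] 𝒦) : IsSymmetricOp (pullback V S) := by
  refine ⟨hS.1.preimage V.toHomeomorph.isOpenMap, fun f g => ?_⟩
  have h := hS.2 ⟨V f, f.2⟩ ⟨V g, g.2⟩
  change ⟪V.symm (S ⟨V f, f.2⟩), (g : ℋ)⟫_ℂ = ⟪(f : ℋ), V.symm (S ⟨V g, g.2⟩)⟫_ℂ
  rwa [← V.inner_map_map, ← V.inner_map_map (f : ℋ), V.apply_symm_apply, V.apply_symm_apply]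

variable [CompleteSpace ℋ] {H : ℋ →ₗ.[ℂ] ℋ}

theorem Intertwines.isFunCalc {α : Type*} [MeasurableSpace α] {μ : Measure α} {h : α → ℝ}
    {hh : Measurable h} {W : Lp ℂ 2 μ ≃ₗᵢ[ℂ] ℋ}
    (hW : Intertwines hh (spectralMeasure H) W.toLinearIsometry) {m : ℝ → ℂ}
    (hm : StronglyMeasurable m) (hmh : MemLp (m ∘ h) ∞ μ) :
    IsFunCalc H m (W.conjStarAlgEquiv (mulOp hmh)) := fun ψ => by
  obtain ⟨f, rfl⟩ := W.surjective ψ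
  have hintegral := hW.integral_vecMeasure hm f
  rw [W.coe_toLinearIsometry] at hintegral
  rw [W.conjStarAlgEquiv_apply_apply, W.symm_apply_apply, W.inner_map_map, inner_mulOp, specMeas,
    hintegral]
  refine integral_congr_ae (.of_forall fun x => ?_)
  simp only [Function.comp_apply, inner_self_eq_norm_sq_to_K]
  rw [Complex.real_smul, mul_comm]
  norm_cast

theorem isStrongTimeOperator_pullback_timeOp (hH : IsSelfAdjoint H) {ρ : ℝ → ℝ}
    (hρ : IsFisherDensity ρ) {V : ℋ ≃ₗᵢ[ℂ] Lp ℂ 2 (densityMeasure ρ)}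
    (hV : Intertwines measurable_id (spectralMeasure H) V.symm.toLinearIsometry) :
    IsStrongTimeOperator H (pullback V (timeOp (densityMeasure ρ) ρ)) := by
  refine ⟨hH, isSymmetricOp_pullback hρ.isSymmetricOp_timeOp V,
    fun t => V.symm.conjStarAlgEquiv (evolution (densityMeasure ρ) t), fun t => ?_, fun t ψ => ?_⟩
  · exact hV.isFunCalc
      (differentiable_of_mem_expSpan (exp_neg_mem_expSpan t)).continuous.stronglyMeasurable _
  · obtain ⟨hmem, hcomm⟩ := hρ.timeOp_evolution t ⟨V ψ, ψ.2⟩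
    have hVU : V (V.symm.conjStarAlgEquiv (evolution (densityMeasure ρ) t) ψ) =
        evolution (densityMeasure ρ) t (V ψ) := by
      rw [V.symm.conjStarAlgEquiv_apply_apply, V.symm_symm, V.apply_symm_apply]
    refine ⟨show V _ ∈ (timeOp (densityMeasure ρ) ρ).domain from hVU.symm ▸ hmem, ?_⟩
    calc V.symm (timeOp (densityMeasure ρ) ρ ⟨V _, _⟩)
        = V.symm (timeOp (densityMeasure ρ) ρ ⟨evolution _ t (V ψ), hmem⟩) := by simp only [hVU]
      _ = V.symm (evolution _ t (V (V.symm (timeOp (densityMeasure ρ) ρ ⟨V ψ, ψ.2⟩) +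
            (t : ℂ) • (ψ : ℋ)))) := by
        rw [hcomm, map_add V, map_smul, V.apply_symm_apply]

namespace IsRegularCyclic

variable {φ : ℋ} {ρ : ℝ → ℝ}

theorem isFisherDensity (h : IsRegularCyclic H φ ρ) : IsFisherDensity ρ where
  nonneg := h.nonneg
  differentiable := h.differentiable
  integrable := by
    refine ⟨h.differentiable.continuous.aestronglyMeasurable, ?_⟩
    rw [hasFiniteIntegral_iff_ofReal (.of_forall h.nonneg), ← setLIntegral_univ,
      ← withDensity_apply _ .univ, ← h.density]
    unfold specMeas
    exact measure_lt_top _ _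
  fisher := h.fisher

theorem exists_pullback_isStrongTimeOperator (hH : IsSelfAdjoint H) (h : IsRegularCyclic H φ ρ) :
    ∃ V : ℋ ≃ₗᵢ[ℂ] Lp ℂ 2 (specMeas H φ), V φ =ᵐ[specMeas H φ] (fun _ => 1) ∧
      pullback V (mulX (specMeas H φ)) = H ∧
        IsStrongTimeOperator H (pullback V (timeOp (specMeas H φ) ρ)) := by
  have hrep := exists_spectral_representation (isSpectralMeasure_spectralMeasure hH h.cyclic)
    hH.dense_domain h.cyclic
  have hμ : (spectralMeasure H).vecMeasure φ = densityMeasure ρ := h.density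
  unfold specMeas
  rw [hμ] at hrep ⊢
  obtain ⟨V, hVφ, hVH, hV⟩ := hrep
  exact ⟨V, hVφ, hVH, isStrongTimeOperator_pullback_timeOp hH h.isFisherDensity hV⟩

end IsRegularCyclic

end StrongTimeOperator

end TimeOp

theorem theorem3 {ℋ : Type*} [NormedAddCommGroup ℋ] [InnerProductSpace ℂ ℋ] [CompleteSpace ℋ]
    [TopologicalSpace.SeparableSpace ℋ] (H : ℋ →ₗ.[ℂ] ℋ) (hH : TimeOp.InS0 H) :
    (∃ T : ℋ →ₗ.[ℂ] ℋ, TimeOp.IsStrongTimeOperator H T) ∧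
    ∀ (φ : ℋ) (ρ : ℝ → ℝ), TimeOp.IsRegularCyclic H φ ρ →
      (∀ t : ℝ, ∃ f ∈ (TimeOp.timeOp (TimeOp.specMeas H φ) ρ).domain,
        (f : ℝ → ℂ) =ᵐ[TimeOp.specMeas H φ] fun x => Complex.exp (Complex.I * t * x)) ∧
      (TimeOp.timeOp (TimeOp.specMeas H φ) ρ).graph =
        TimeOp.timeGraph (TimeOp.specMeas H φ) ρ ∧
      ∃ V : ℋ ≃ₗᵢ[ℂ] Lp ℂ 2 (TimeOp.specMeas H φ),
        ((V φ : ℝ → ℂ) =ᵐ[TimeOp.specMeas H φ] fun _ => 1) ∧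
        TimeOp.pullback V (TimeOp.mulX (TimeOp.specMeas H φ)) = H ∧
        TimeOp.IsStrongTimeOperator H
          (TimeOp.pullback V (TimeOp.timeOp (TimeOp.specMeas H φ) ρ)) := by
  refine ⟨?_, fun φ ρ h => ⟨fun t => ?_, ?_, h.exists_pullback_isStrongTimeOperator hH.selfAdjoint⟩⟩
  · obtain ⟨φ, ρ, h⟩ := hH.exists_cyclic
    obtain ⟨V, -, -, hT⟩ := h.exists_pullback_isStrongTimeOperator hH.selfAdjoint
    exact ⟨_, hT⟩
  · rw [h.density]
    exact h.isFisherDensity.exists_mem_domain_timeOp (TimeOp.exp_mem_expSpan t)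
  · rw [h.density]
    exact h.isFisherDensity.timeOp_graph
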